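/- Let $n,k\ge 1$ be integers, let $c_0,\dots,c_n$ be non-zero integers with $\gcd(c_0,\dots,c_n)=1$, and let $m_0,\dots,m_n\ge 2$ be integers. Let $X\subset\mathbb{P}^n_{\mathbb{Q}}$ be the hypersurface $\sum_{i=0}^n c_ix_i^k=0$, let $D_i=\{x_i=0\}\cap X$, and let $D=\sum_{i=0}^n\left(1-\frac1{m_i}\right)D_i$. Let $S$ be a finite set of places of $\mathbb{Q}$ containing $\infty$ and all primes dividing $k\cdot\prod_{i=0}^n c_i$, and let $\mathbb{Z}_S\subset\mathbb{Q}$ be the ring of $S$-integers. Let $\mathcal{X}\subset\mathbb{P}^n_{\mathbb{Z}_S}$ be the closed subscheme $\sum_{i=0}^n c_ix_i^k=0$, let $\mathcal{D}_i=\{x_i=0\}\cap\mathcal{X}$ (as schemes), and let $\mathcal{D}=\sum_{i=0}^n\left(1-\frac1{m_i}\right)\mathcal{D}_i$. Then $\mathcal{X}$ is smooth over $\mathbb{Z}_S$. Moreover the pair $(\mathcal{X},\mathcal{D})$ is smooth over $\mathbb{Z}_S$ of relative dimension $n-1$: for every $J\subseteq\{0,\dots,n\}$ the intersection of the $\mathcal{D}_i$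 with $i\in J$ (which is $\mathcal{X}$ for $J=\emptyset$) is smooth over $\mathbb{Z}_S$ of relative dimension $n-1-\#J$ if $\#J\le n-1$, and is empty if $\#J\ge n$. Hence $(\mathcal{X},\mathcal{D})$ is a good integral model of $(X,D)$ over $\mathbb{Z}_S$: $\mathcal{X}$ is flat and proper over $\mathbb{Z}_S$ with generic fibre $X$, each $\mathcal{D}_i$ is the scheme-theoretic closure of $D_i$ in $\mathcal{X}$, and $\mathcal{X}$ is a regular scheme. -/

import Mathlib

open AlgebraicGeometry CategoryTheory IsDedekindDomain

noncomputable section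

/-! ### Quotients of graded rings by homogeneous ideals -/

section QuotientGrading

variable {R A : Type*} [CommRing R] [CommRing A] [Algebra R A]
  {𝒜 : ℕ → Submodule R A} [GradedAlgebra 𝒜]

/-- The degree `i` part of `A ⧸ I` is the image of the degree `i` part of `A`. -/
def quotGrading (I : HomogeneousIdeal 𝒜) (i : ℕ) : Submodule R (A ⧸ I.toIdeal) :=
  (𝒜 i).map (Ideal.Quotient.mkₐ R I.toIdeal).toLinearMap

lemma mk_mem_quotGrading (I : HomogeneousIdeal 𝒜) {i : ℕ} {a : A} (ha : a ∈ 𝒜 i) :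
    Ideal.Quotient.mk I.toIdeal a ∈ quotGrading I i :=
  ⟨a, ha, rfl⟩

instance quotGrading.gradedMonoid (I : HomogeneousIdeal 𝒜) :
    SetLike.GradedMonoid (quotGrading I) where
  one_mem := mk_mem_quotGrading I SetLike.GradedOne.one_mem
  mul_mem := by
    rintro i j _ _ ⟨a, ha, rfl⟩ ⟨b, hb, rfl⟩
    exact mk_mem_quotGrading I (SetLike.GradedMul.mul_mem ha hb)

/-- The quotient map on the degree `i` parts. -/
def quotGradingMk (I : HomogeneousIdeal 𝒜) (i : ℕ) : 𝒜 i →ₗ[R] quotGrading I i :=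
  (Ideal.Quotient.mkₐ R I.toIdeal).toLinearMap.restrict fun _ ha => mk_mem_quotGrading I ha

/-- Decomposing an element of `A` and reducing its homogeneous components modulo `I`. -/
def quotGradingPreDecompose (I : HomogeneousIdeal 𝒜) :
    A →ₗ[R] DirectSum ℕ fun i => quotGrading I i :=
  DirectSum.lmap (quotGradingMk I) ∘ₗ (DirectSum.decomposeLinearEquiv 𝒜).toLinearMap

lemma quotGradingPreDecompose_eq_zero (I : HomogeneousIdeal 𝒜) {a : A} (ha : a ∈ I.toIdeal) :
    quotGradingPreDecompose I a = 0 := by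
  refine DFinsupp.ext fun i => Subtype.ext ?_
  exact Ideal.Quotient.eq_zero_iff_mem.mpr (I.isHomogeneous i ha)

/-- Decomposing an element of `A ⧸ I` into its homogeneous components. -/
def quotGradingDecompose (I : HomogeneousIdeal 𝒜) :
    (A ⧸ I.toIdeal) →+ DirectSum ℕ fun i => quotGrading I i :=
  QuotientAddGroup.lift I.toIdeal.toAddSubgroup (quotGradingPreDecompose I).toAddMonoidHom
    fun _ ha => quotGradingPreDecompose_eq_zero I ha

lemma quotGradingDecompose_mk (I : HomogeneousIdeal 𝒜) (a : A) :
    quotGradingDecompose I (Ideal.Quotient.mk I.toIdeal a) =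
      DirectSum.lmap (quotGradingMk I) (DirectSum.decompose 𝒜 a) :=
  rfl

/-- The quotient of a graded ring by a homogeneous ideal is a graded ring. -/
instance quotGrading.gradedAlgebra (I : HomogeneousIdeal 𝒜) : GradedAlgebra (quotGrading I) where
  toDecomposition := DirectSum.Decomposition.ofAddHom _ (quotGradingDecompose I)
    (by
      refine AddMonoidHom.ext fun x => ?_
      obtain ⟨a, rfl⟩ := Ideal.Quotient.mk_surjective x
      rw [AddMonoidHom.comp_apply, quotGradingDecompose_mk]
      induction a using DirectSum.Decomposition.inductionOn 𝒜 with
      | zero => simp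
      | homogeneous a =>
        rw [DirectSum.decompose_coe, DirectSum.lmap_of, DirectSum.coeAddMonoidHom_of]
        rfl
      | add a b ha hb => simp only [DirectSum.decompose_add, map_add, ha, hb])
    (by
      refine DirectSum.addHom_ext fun i y => ?_
      obtain ⟨_, a, ha, rfl⟩ := y
      rw [AddMonoidHom.comp_apply, DirectSum.coeAddMonoidHom_of, AddMonoidHom.id_apply]
      refine (quotGradingDecompose_mk I a).trans ?_
      rw [DirectSum.decompose_of_mem _ ha, DirectSum.lmap_of]
      rfl)

/-- For `I ≤ J`, the graded surjection `A ⧸ I → A ⧸ J`. -/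
def quotGradingFactor {I J : HomogeneousIdeal 𝒜} (h : I.toIdeal ≤ J.toIdeal) :
    quotGrading I →+*ᵍ quotGrading J where
  __ := Ideal.Quotient.factor h
  map_mem := by
    rintro i _ ⟨a, ha, rfl⟩
    exact mk_mem_quotGrading J ha

lemma irrelevant_le_map_quotGradingFactor {I J : HomogeneousIdeal 𝒜}
    (h : I.toIdeal ≤ J.toIdeal) :
    HomogeneousIdeal.irrelevant (quotGrading J) ≤
      (HomogeneousIdeal.irrelevant (quotGrading I)).map (quotGradingFactor h) := by
  rw [HomogeneousIdeal.irrelevant_le]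
  rintro i hi _ ⟨a, ha, rfl⟩
  exact Ideal.mem_map_of_mem (quotGradingFactor h)
    (HomogeneousIdeal.mem_irrelevant_of_mem (quotGrading I) hi (mk_mem_quotGrading I ha))

end QuotientGrading

/-! ### Closed subschemes of projective space cut out by homogeneous ideals -/

section ProjectiveSubscheme

attribute [local instance] MvPolynomial.gradedAlgebra

variable {R : Type} [CommRing R] {n : ℕ}

/-- The closed subscheme `Proj (R[x₀, …, xₙ] / I)` of `ℙⁿ` over `R`. -/
def projZeroLocus (I : HomogeneousIdeal (MvPolynomial.homogeneousSubmodule (Fin (n + 1)) R)) :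
    Scheme.{0} :=
  Proj (quotGrading I)

/-- The structure morphism `Proj (R[x₀, …, xₙ] / I) ⟶ Spec R`. -/
def projZeroLocus.toSpec
    (I : HomogeneousIdeal (MvPolynomial.homogeneousSubmodule (Fin (n + 1)) R)) :
    projZeroLocus I ⟶ Spec (.of R) :=
  Proj.toSpecZero (quotGrading I) ≫
    Spec.map (CommRingCat.ofHom (algebraMap R (quotGrading I 0)))

/-- For `I ≤ J`, the closed immersion `Proj (R[x₀, …, xₙ] / J) ⟶ Proj (R[x₀, …, xₙ] / I)`. -/
def projZeroLocus.incl
    {I J : HomogeneousIdeal (MvPolynomial.homogeneousSubmodule (Fin (n + 1)) R)}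
    (h : I.toIdeal ≤ J.toIdeal) : projZeroLocus J ⟶ projZeroLocus I :=
  Proj.map (quotGradingFactor h) (irrelevant_le_map_quotGradingFactor h)

/-- The homogeneous ideal generated by `c₀ x₀ᵏ + ⋯ + cₙ xₙᵏ` and the variables `xᵢ`, `i ∈ T`. -/
def diagonalIdeal (c : Fin (n + 1) → R) (k : ℕ) (T : Set (Fin (n + 1))) :
    HomogeneousIdeal (MvPolynomial.homogeneousSubmodule (Fin (n + 1)) R) where
  toSubmodule := Ideal.span
    (insert (∑ i, MvPolynomial.C (c i) * MvPolynomial.X i ^ k) (MvPolynomial.X '' T))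
  is_homogeneous' := by
    refine Ideal.homogeneous_span _ _ ?_
    rintro _ (rfl | ⟨i, -, rfl⟩)
    · exact ⟨k, MvPolynomial.IsHomogeneous.sum _ _ _ fun i _ =>
        (MvPolynomial.isHomogeneous_C_mul_X_pow (c i) i k)⟩
    · exact ⟨1, MvPolynomial.isHomogeneous_X R i⟩

lemma diagonalIdeal_mono (c : Fin (n + 1) → R) (k : ℕ) {T T' : Set (Fin (n + 1))} (h : T ⊆ T') :
    (diagonalIdeal c k T).toIdeal ≤ (diagonalIdeal c k T').toIdeal :=
  Ideal.span_mono (Set.insert_subset_insert (Set.image_mono h))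

end ProjectiveSubscheme

/-! ### Schemes with a `ℚ`-divisor and their integral models -/

/-- A scheme `X` over `B` with a formal sum `D = ∑ εᵢ Dᵢ` of closed subschemes `Dᵢ` of `X`, each
given by its ideal sheaf, with rational weights `εᵢ`. -/
structure SchemeWithDivisor (B : Scheme.{0}) (ι : Type) where
  /-- the underlying scheme -/
  X : Scheme.{0}
  /-- the structure morphism -/
  str : X ⟶ B
  /-- the components of the divisor -/
  D : ι → X.IdealSheafData
  /-- the weights of the components -/
  ε : ι → ℚ

/-- The pair `(X, D)` over `R` given by the hypersurface `X : c₀ x₀ᵏ + ⋯ + cₙ xₙᵏ = 0` in `ℙⁿ`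
and `D = ∑ (1 - 1 / mᵢ) Dᵢ` with `Dᵢ = {xᵢ = 0} ∩ X`. -/
def diagonalPair (R : Type) [CommRing R] {n : ℕ} (c : Fin (n + 1) → R) (k : ℕ)
    (m : Fin (n + 1) → ℕ) : SchemeWithDivisor (Spec (.of R)) (Fin (n + 1)) where
  X := projZeroLocus (diagonalIdeal c k ∅)
  str := projZeroLocus.toSpec (diagonalIdeal c k ∅)
  D i := (projZeroLocus.incl (diagonalIdeal_mono c k (Set.empty_subset {i}))).ker
  ε i := 1 - 1 / (m i : ℚ)

/-- A scheme is regular if it is locally Noetherian and all its local rings are regular. -/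
structure IsRegularScheme (X : Scheme.{0}) : Prop where
  isLocallyNoetherian : IsLocallyNoetherian X
  isRegularLocalRing_stalk : ∀ x : X, IsRegularLocalRing (X.presheaf.stalk x)

/-- `(𝒳, 𝒟)` over `R` is a proper integral model of `(X, D)` over the fraction field `F` of `R`:
`𝒳` is flat and proper over `R`, its generic fibre is `X`, and `𝒟 = ∑ εᵢ 𝒟ᵢ` where `𝒟ᵢ` is the
(scheme-theoretic) closure in `𝒳` of `Dᵢ ⊆ X`. -/
structure IsProperIntegralModel {R F : Type} [CommRing R] [Field F] [Algebra R F] {ι : Type}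
    (P : SchemeWithDivisor (Spec (.of F)) ι) (M : SchemeWithDivisor (Spec (.of R)) ι) : Prop where
  flat : Flat M.str
  proper : IsProper M.str
  weights : M.ε = P.ε
  exists_genericFibre : ∃ j : P.X ⟶ M.X,
    IsPullback j P.str M.str (Spec.map (CommRingCat.ofHom (algebraMap R F))) ∧
      ∀ i, M.D i = (P.D i).map j

/-- A good integral model is a proper integral model whose underlying scheme is regular. -/
structure IsGoodIntegralModel {R F : Type} [CommRing R] [Field F] [Algebra R F] {ι : Type}
    (P : SchemeWithDivisor (Spec (.of F)) ι) (M : SchemeWithDivisor (Spec (.of R)) ι) : Prop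
    extends IsProperIntegralModel P M where
  regular : IsRegularScheme M.X

namespace SchemeWithDivisor

variable {B : Scheme.{0}} {ι : Type} (P : SchemeWithDivisor B ι)

/-- The ideal sheaf of the intersection of the `Dᵢ` with `i ∈ J` (all of `X` when `J` is empty). -/
def inter (J : Finset ι) : P.X.IdealSheafData := J.sup P.D

/-- `(X, D)` is smooth over `B` of relative dimension `d`: the morphism `X ⟶ B` is smooth of
relative dimension `d` and `∑ Dᵢ` has strict normal crossings relative to `B`, that is,
every intersection of `r` of the `Dᵢ` is smooth over `B` of relative dimension `d - r`
(empty when `r > d`). -/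
def IsSmoothPair (d : ℕ) : Prop :=
  ∀ J : Finset ι,
    (J.card ≤ d → SmoothOfRelativeDimension (d - J.card) ((P.inter J).subschemeι ≫ P.str)) ∧
    (d < J.card → IsEmpty (P.inter J).subscheme)

end SchemeWithDivisor

end

/-! Over `ℤ_S` the integer `k` and all `cᵢ` are units, and this is the only arithmetic input to
smoothness. On the chart `xⱼ = 1`, with the coordinates in `J` set to zero, take `i ≠ j` outside
`J`. Where `xᵢ` is invertible the equation says that `xᵢᵏ` is a polynomial in the remaining `n - 1 -
#J` free coordinates. Since `k` and `xᵢ` are units, adjoining this root is étale (a Kummer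
covering), so this locus is étale over an affine space
(`DiagonalChart.etale_of_isLocalization_away`). These loci cover the chart: if every other
coordinate vanished, the equation would read `cⱼ = 0` (`DiagonalChart.span_range_x`). When `#J ≥ n`
there is no such `i`, so the chart is empty.

The scheme `Proj` is glued from these charts (`awayToChart_bijective`, `chartCover`). Both the
closed immersions cutting out coordinate hyperplanes and the change of base ring are Cartesian over
the charts (`isPullback_chartι`), so questions about intersections and generic fibres become
questions about explicit quotient rings.

For the integral model, smoothness gives flatness and `Proj` gives properness. The closure of `Dᵢ`
is `𝒟ᵢ` because `𝒟ᵢ` is flat over the base and `Spec ℚ ⟶ Spec ℤ_S` is scheme-theoretically dominant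
(`projZeroLocus.ker_incl_map_baseChange`). Regularity ascends from the Dedekind ring `ℤ_S` along
smooth maps (`IsRegularRing.of_smooth`). -/

/-! ### Ascent of regularity along smooth ring maps -/

open IsLocalRing in
-- Let `q` lie over `p`. Unramifiedness makes the maximal ideal of `A_p` generate that of `B_q`, so
-- the number of generators does not grow; going down makes the dimension not drop. Hence the
-- maximal ideal of `B_q` needs at most `dim A_p ≤ dim B_q` generators.
theorem IsRegularRing.of_etale (A B : Type*) [CommRing A] [CommRing B] [Algebra A B]
    [IsRegularRing A] [Algebra.Etale A B] : IsRegularRing B := by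
  have : IsNoetherianRing B := Algebra.FiniteType.isNoetherianRing A B
  refine isRegularRing_iff.mpr fun q hq => ?_
  let p := q.under A
  have : p.IsPrime := Ideal.IsPrime.under A q
  have : q.LiesOver p := ⟨rfl⟩
  have hreg : IsRegularLocalRing (Localization.AtPrime p) := inferInstance
  have hle : p.height ≤ q.height := by
    rw [Ideal.height_eq_height_add_of_liesOver_of_hasGoingDown p q]
    exact le_self_add
  have hmap : p.map (algebraMap A (Localization.AtPrime q)) =
      maximalIdeal (Localization.AtPrime q) := by
    let := Localization.AtPrime.algebraOfLiesOver p q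
    have : Algebra.IsUnramifiedAt A q := inferInstance
    exact ((Algebra.isUnramifiedAt_iff_map_eq A p q).mp this).2
  have hmap' : (maximalIdeal (Localization.AtPrime p)).map
      (Localization.localRingHom p q (algebraMap A B) rfl) =
      maximalIdeal (Localization.AtPrime q) := by
    rw [← hmap, ← Localization.AtPrime.map_eq_maximalIdeal, Ideal.map_map]
    congr 1
    ext x
    simp [Localization.localRingHom_to_map, IsScalarTower.algebraMap_apply A B (Localization.AtPrime q)]
  apply IsRegularLocalRing.of_spanFinrank_maximalIdeal_le
  have fg := (maximalIdeal (Localization.AtPrime p)).fg_of_isNoetherianRing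
  have h1 : (maximalIdeal (Localization.AtPrime q)).spanFinrank ≤
      (maximalIdeal (Localization.AtPrime p)).spanFinrank := by
    rw [← hmap', ← Submodule.FG.generators_ncard fg]
    conv_lhs => rw [← (maximalIdeal (Localization.AtPrime p)).span_generators]
    have fin := Submodule.FG.finite_generators fg
    change Submodule.spanFinrank (Ideal.map _ (Ideal.span _)) ≤ _
    rw [Ideal.map_span]
    exact (Submodule.spanFinrank_span_le_ncard_of_finite (fin.image _)).trans (Set.ncard_image_le fin)
  calc ((maximalIdeal (Localization.AtPrime q)).spanFinrank : WithBot ℕ∞)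
      ≤ ((maximalIdeal (Localization.AtPrime p)).spanFinrank : WithBot ℕ∞) := by exact_mod_cast h1
    _ = ringKrullDim (Localization.AtPrime p) := hreg.spanFinrank_maximalIdeal
    _ ≤ ringKrullDim (Localization.AtPrime q) := by
      rw [IsLocalization.AtPrime.ringKrullDim_eq_height p,
        IsLocalization.AtPrime.ringKrullDim_eq_height q]
      exact_mod_cast hle

/-- A standard smooth algebra is étale over a polynomial ring, and polynomial rings over regular
rings are regular. -/
theorem IsRegularRing.of_isStandardSmooth (A B : Type*) [CommRing A] [CommRing B] [Algebra A B]
    [IsRegularRing A] [Algebra.IsStandardSmooth A B] : IsRegularRing B := by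
  obtain ⟨n, g, hg, het⟩ := RingHom.IsStandardSmooth.exists_etale_mvPolynomial
    (f := algebraMap A B) (RingHom.isStandardSmooth_algebraMap.mpr ‹_›)
  algebraize [g]
  exact IsRegularRing.of_etale (MvPolynomial (Fin n) A) B

/-- Regularity is a condition at each prime, and near a given prime a smooth algebra is standard
smooth; the local ring is unchanged by first inverting `f ∉ q`. -/
theorem IsRegularRing.of_smooth (A B : Type*) [CommRing A] [CommRing B] [Algebra A B]
    [IsRegularRing A] [Algebra.Smooth A B] : IsRegularRing B := by
  have : IsNoetherianRing B := Algebra.FiniteType.isNoetherianRing A B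
  refine isRegularRing_iff.mpr fun q hq => ?_
  obtain ⟨f, hf, _⟩ := Algebra.IsSmoothAt.exists_notMem_isStandardSmooth A q
  have : IsRegularRing (Localization.Away f) := .of_isStandardSmooth A _
  have hdisj : Disjoint (Submonoid.powers f : Set B) (q : Set B) :=
    (Ideal.disjoint_powers_iff_notMem_of_isPrime _).mpr hf
  let Q := q.map (algebraMap B (Localization.Away f))
  have : Q.IsPrime := IsLocalization.isPrime_of_isPrime_disjoint (.powers f) _ _ ‹_› hdisj
  have : IsLocalization.AtPrime (Localization.AtPrime Q) q := by
    convert IsLocalization.isLocalization_isLocalization_atPrime_isLocalization (.powers f)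
      (Localization.AtPrime Q) Q
    exact (IsLocalization.under_map_of_isPrime_disjoint (.powers f) _ ‹_› hdisj).symm
  exact IsRegularLocalRing.of_ringEquiv (IsLocalization.algEquiv q.primeCompl
    (Localization.AtPrime Q) (Localization.AtPrime q)).toRingEquiv

/-! ### Affine charts of the diagonal hypersurface and their smoothness -/

noncomputable section

/-- The presentation without relations works: its Jacobian is an empty determinant, hence `1`. -/
theorem MvPolynomial.isStandardSmoothOfRelativeDimension (σ R : Type*) [CommRing R] [Finite σ] :
    Algebra.IsStandardSmoothOfRelativeDimension (Nat.card σ) R (MvPolynomial σ R) := by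
  let P : Algebra.SubmersivePresentation R (MvPolynomial σ R) σ PEmpty.{1} :=
    { toGenerators := Algebra.Generators.mvPolynomial R σ
      relation := PEmpty.elim
      span_range_relation_eq_ker := by
        simp only [Set.range_eq_empty, Ideal.span_empty]
        symm
        rw [Algebra.Generators.ker_eq_ker_aeval_val]
        exact (RingHom.injective_iff_ker_eq_bot _).mp
          (by simpa [Algebra.Generators.mvPolynomial] using! Function.injective_id)
      map := PEmpty.elim
      map_inj := fun x => x.elim
      jacobian_isUnit := by
        classical
        rw [Algebra.PreSubmersivePresentation.jacobian_eq_jacobiMatrix_det]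
        simp }
  exact P.isStandardSmoothOfRelativeDimension (by simp [Algebra.Presentation.dimension])

section Chart

open MvPolynomial

variable {R : Type} [CommRing R] {n : ℕ} (c : Fin (n + 1) → R) (k : ℕ) (T : Set (Fin (n + 1)))
  (j : Fin (n + 1))

/-- The dehomogenization at `xⱼ = 1` of the ideal generated by the diagonal form and the variables
indexed by `T`. -/
def diagonalChartIdeal : Ideal (MvPolynomial (Fin (n + 1)) R) :=
  Ideal.span (insert (X j - 1) (insert (∑ i, C (c i) * X i ^ k) (X '' T)))

/-- The coordinate ring of the affine chart `xⱼ = 1` of the diagonal hypersurface intersected with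
the coordinate hyperplanes indexed by `T`. -/
def DiagonalChart : Type :=
  MvPolynomial (Fin (n + 1)) R ⧸ diagonalChartIdeal c k T j

instance : CommRing (DiagonalChart c k T j) :=
  inferInstanceAs (CommRing (MvPolynomial (Fin (n + 1)) R ⧸ diagonalChartIdeal c k T j))

/-- The quotient map onto the coordinate ring of an affine chart. -/
def DiagonalChart.mk : MvPolynomial (Fin (n + 1)) R →+* DiagonalChart c k T j :=
  Ideal.Quotient.mk (diagonalChartIdeal c k T j)

instance : Algebra R (DiagonalChart c k T j) :=
  ((DiagonalChart.mk c k T j).comp C).toAlgebra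

/-- The coordinate functions on an affine chart. -/
def DiagonalChart.x (l : Fin (n + 1)) : DiagonalChart c k T j :=
  DiagonalChart.mk c k T j (X l)

namespace DiagonalChart

lemma mk_eq_zero_iff {p : MvPolynomial (Fin (n + 1)) R} :
    mk c k T j p = 0 ↔ p ∈ diagonalChartIdeal c k T j :=
  Ideal.Quotient.eq_zero_iff_mem

lemma mk_C (r : R) : mk c k T j (C r) = algebraMap R _ r := rfl

lemma mk_X (l : Fin (n + 1)) : mk c k T j (X l) = x c k T j l := rfl

lemma x_self : x c k T j j = 1 := by
  rw [← sub_eq_zero, ← map_one (mk c k T j), x, ← map_sub, mk_eq_zero_iff]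
  exact Ideal.subset_span (Set.mem_insert _ _)

lemma x_eq_zero {l : Fin (n + 1)} (hl : l ∈ T) : x c k T j l = 0 :=
  (mk_eq_zero_iff c k T j).mpr (Ideal.subset_span
    (Set.mem_insert_of_mem _ (Set.mem_insert_of_mem _ ⟨l, hl, rfl⟩)))

lemma sum_eq_zero : ∑ i, algebraMap R _ (c i) * x c k T j i ^ k = 0 := by
  have : mk c k T j (∑ i, C (c i) * X i ^ k) = 0 :=
    (mk_eq_zero_iff c k T j).mpr (Ideal.subset_span
      (Set.mem_insert_of_mem _ (Set.mem_insert _ _)))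
  rw [← this, map_sum]
  simp only [map_mul, map_pow]
  rfl

variable {c k T j} in
/-- The universal property of the coordinate ring of an affine chart. -/
def lift {B : Type*} [CommRing B] (f : MvPolynomial (Fin (n + 1)) R →+* B)
    (hf : diagonalChartIdeal c k T j ≤ RingHom.ker f) : DiagonalChart c k T j →+* B :=
  Ideal.Quotient.lift _ f hf

variable {c k T j} in
lemma lift_mk {B : Type*} [CommRing B] (f : MvPolynomial (Fin (n + 1)) R →+* B)
    (hf : diagonalChartIdeal c k T j ≤ RingHom.ker f) (p : MvPolynomial (Fin (n + 1)) R) :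
    lift f hf (mk c k T j p) = f p :=
  Ideal.Quotient.lift_mk _ _ _

lemma mk_surjective : Function.Surjective (mk c k T j) :=
  Ideal.Quotient.mk_surjective

variable {c k T j} in
lemma hom_ext {B : Type*} [CommRing B] {f g : DiagonalChart c k T j →+* B}
    (hC : ∀ r : R, f (algebraMap R _ r) = g (algebraMap R _ r))
    (hX : ∀ l, f (x c k T j l) = g (x c k T j l)) : f = g :=
  Ideal.Quotient.ringHom_ext (MvPolynomial.ringHom_ext hC hX)

variable {c k} {T} {j} in
lemma ringHom_ext {L B : Type*} [CommRing L] [CommRing B] [Algebra (DiagonalChart c k T j) L]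
    (i : Fin (n + 1)) [IsLocalization.Away (x c k T j i) L] {f g : L →+* B}
    (hC : ∀ r : R, f (algebraMap (DiagonalChart c k T j) L (algebraMap R _ r)) =
      g (algebraMap (DiagonalChart c k T j) L (algebraMap R _ r)))
    (hX : ∀ l, f (algebraMap (DiagonalChart c k T j) L (x c k T j l)) =
      g (algebraMap (DiagonalChart c k T j) L (x c k T j l))) : f = g :=
  IsLocalization.ringHom_ext (.powers (x c k T j i)) (hom_ext hC hX)

variable {c k} in
-- Modulo the coordinates other than `xⱼ = 1` the equation becomes `cⱼ = 0`, and `cⱼ` is a unit.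
-- Coordinates in `T` are already zero and may be left out.
lemma span_range_x (hc : ∀ i, IsUnit (c i)) (hk : k ≠ 0) :
    Ideal.span (Set.range fun i : {i // i ∉ T ∧ i ≠ j} => x c k T j i) = ⊤ := by
  set I := Ideal.span (Set.range fun i : {i // i ∉ T ∧ i ≠ j} => x c k T j i)
  have hx : ∀ i ≠ j, x c k T j i ∈ I := fun i hi => by
    by_cases hT : i ∈ T
    · rw [x_eq_zero c k T j hT]
      exact zero_mem I
    · exact Ideal.subset_span ⟨⟨i, hT, hi⟩, rfl⟩
  refine Ideal.eq_top_of_isUnit_mem I (x := algebraMap R _ (c j)) ?_ ((hc j).map _)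
  have h := sum_eq_zero c k T j
  rw [← Finset.add_sum_erase _ _ (Finset.mem_univ j), x_self, one_pow, mul_one,
    add_eq_zero_iff_eq_neg] at h
  rw [h]
  exact neg_mem (sum_mem fun i hi => Ideal.mul_mem_left _ _
    (Ideal.pow_mem_of_mem _ (hx i (Finset.ne_of_mem_erase hi)) _ (Nat.pos_of_ne_zero hk)))

variable {c k} in
-- Either `j ∈ T`, and then `1 = xⱼ = 0`, or `T` together with `j` exhausts the indices, and the
-- empty family generates the unit ideal by `span_range_x`.
lemma subsingleton_of_le_card (hc : ∀ i, IsUnit (c i)) (hk : k ≠ 0) {T : Finset (Fin (n + 1))}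
    (hT : n ≤ T.card) : Subsingleton (DiagonalChart c k T j) := by
  by_cases hj : j ∈ T
  · rw [← subsingleton_iff_zero_eq_one, ← x_self c k T j]
    exact (x_eq_zero c k T j hj).symm
  · have : IsEmpty {i // i ∉ (T : Set (Fin (n + 1))) ∧ i ≠ j} := by
      refine ⟨fun ⟨i, hi, hij⟩ => ?_⟩
      have h := Finset.card_le_univ (insert i (insert j T))
      rw [Finset.card_insert_of_notMem (by simpa [hij] using hi),
        Finset.card_insert_of_notMem hj, Fintype.card_fin] at h
      omega
    have h := span_range_x (T : Set _) j hc hk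
    rw [Set.range_eq_empty, Ideal.span_empty] at h
    rw [← subsingleton_iff_zero_eq_one, eq_comm, ← Ideal.mem_bot, h]
    trivial

end DiagonalChart

lemma sum_eq_add_add_sum_subtype {ι M : Type*} [Fintype ι] [DecidableEq ι] [AddCommMonoid M]
    {T : Set ι} {i j : ι} (hij : i ≠ j) [Fintype {l // l ∉ T ∧ l ≠ i ∧ l ≠ j}]
    (f : ι → M) (hf : ∀ l ∈ T, l ≠ i → l ≠ j → f l = 0) :
    ∑ l, f l = f i + (f j + ∑ l : {l // l ∉ T ∧ l ≠ i ∧ l ≠ j}, f l) := by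
  classical
  rw [← Finset.add_sum_erase _ _ (Finset.mem_univ i),
    ← Finset.add_sum_erase _ _ (Finset.mem_erase.mpr ⟨hij.symm, Finset.mem_univ j⟩)]
  congr 2
  rw [← Finset.sum_subtype (s := Finset.univ.filter fun l => l ∉ T ∧ l ≠ i ∧ l ≠ j) (by simp)]
  refine (Finset.sum_subset ?_ ?_).symm
  · intro l hl
    simp_all
  · intro l hl hl'
    simp only [Finset.mem_erase, Finset.mem_univ, and_true, Finset.mem_filter, true_and,
      not_and, not_not] at hl hl'
    by_cases hT : l ∈ T
    · exact hf l hT hl.2 hl.1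
    · exact absurd (hl' hT hl.2) hl.1

/-- The standard étale pair `zᵏ + a`, localized at `z`. -/
def kummerPair {A : Type*} [CommRing A] (a : A) {k : ℕ} (hk : k ≠ 0) (u : A) (hu : k * u = 1) :
    StandardEtalePair A where
  f := .X ^ k + .C a
  monic_f := Polynomial.monic_X_pow_add_C _ hk
  g := .X
  cond := ⟨.C u, 0, k - 1, by
    rw [Polynomial.derivative_add, Polynomial.derivative_X_pow, Polynomial.derivative_C,
      add_zero, mul_zero, add_zero, mul_right_comm, ← Polynomial.C_mul, hu, map_one, one_mul]⟩

lemma kummerPair_hasMap {A B : Type*} [CommRing A] [CommRing B] [Algebra A B] (a : A) {k : ℕ}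
    (hk : k ≠ 0) (u : A) (hu : k * u = 1) (x : B) :
    (kummerPair a hk u hu).HasMap x ↔ x ^ k + algebraMap A B a = 0 ∧ IsUnit x := by
  simp [StandardEtalePair.HasMap, kummerPair]

/-- The hypothesis `hx` replaces generation of `L` by `x`: it is what makes the composite `L →
P.Ring → L` the identity. The other composite is handled by the universal property of `P.Ring`. -/
lemma StandardEtalePair.etale_of_hasMap {A L : Type*} [CommRing A] [CommRing L] [Algebra A L]
    (P : StandardEtalePair A) {x : L} (hP : P.HasMap x) (ψ : L →ₐ[A] P.Ring) (hψ : ψ x = P.X)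
    (hx : ∀ f : L →ₐ[A] L, f x = x → f = AlgHom.id A L) : Algebra.Etale A L := by
  refine .of_equiv (AlgEquiv.ofAlgHom (P.lift x hP) ψ (hx _ ?_) (P.hom_ext ?_))
  · rw [AlgHom.comp_apply, hψ, P.lift_X]
  · rw [AlgHom.comp_apply, P.lift_X, hψ, AlgHom.id_apply]

variable {c k} {T} in
/-- On the locus `xᵢ ≠ 0`, a chart is a Kummer covering of an affine space. -/
lemma DiagonalChart.etale_of_isLocalization_away (hc : ∀ i, IsUnit (c i)) (hk : k ≠ 0)
    (hu : IsUnit (k : R)) {i j : Fin (n + 1)} (hi : i ∉ T) (hj : j ∉ T) (hij : i ≠ j)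
    (L : Type) [CommRing L] [Algebra (DiagonalChart c k T j) L]
    [IsLocalization.Away (x c k T j i) L]
    [Algebra (MvPolynomial {l // l ∉ T ∧ l ≠ i ∧ l ≠ j} R) L]
    (hC : ∀ r : R, algebraMap (MvPolynomial {l // l ∉ T ∧ l ≠ i ∧ l ≠ j} R) L (C r) =
      algebraMap (DiagonalChart c k T j) L (algebraMap R _ r))
    (hX : ∀ l, algebraMap (MvPolynomial {l // l ∉ T ∧ l ≠ i ∧ l ≠ j} R) L (X l) =
      algebraMap (DiagonalChart c k T j) L (x c k T j l)) :
    Algebra.Etale (MvPolynomial {l // l ∉ T ∧ l ≠ i ∧ l ≠ j} R) L := by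
  classical
  have : Fintype {l // l ∉ T ∧ l ≠ i ∧ l ≠ j} := Fintype.ofFinite _
  obtain ⟨v, hv⟩ := hu.exists_right_inv
  obtain ⟨b, hb⟩ := (hc i).exists_left_inv
  let A := MvPolynomial {l // l ∉ T ∧ l ≠ i ∧ l ≠ j} R
  -- Dividing the equation by `cᵢ` and putting `xⱼ = 1` turns it into `xᵢᵏ + a = 0`; `b` is the
  -- inverse of `cᵢ`.
  let a : A := C b * (C (c j) + ∑ l : {l // l ∉ T ∧ l ≠ i ∧ l ≠ j}, C (c l) * X l ^ k)
  -- Only the description of `HasMap` as "a root that is a unit" is retained, so `P` is opaque from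
  -- here on.
  obtain ⟨P, hPmap⟩ : ∃ P : StandardEtalePair A, ∀ (B : Type) [CommRing B] [Algebra A B] (x : B),
      P.HasMap x ↔ x ^ k + algebraMap A B a = 0 ∧ IsUnit x :=
    ⟨kummerPair a hk (C v) (by rw [← map_natCast C, ← C_mul, hv, C_1]), fun _ _ _ _ =>
      kummerPair_hasMap _ _ _ _ _⟩
  obtain ⟨hPX, hPu⟩ := (hPmap _ _).mp P.hasMap_X
  have hP : P.HasMap (algebraMap _ L (x c k T j i)) := by
    refine (hPmap _ _).mpr ⟨?_, IsLocalization.Away.algebraMap_isUnit (x c k T j i)⟩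
    have h := congr(algebraMap _ L (algebraMap R _ b * $(sum_eq_zero c k T j)))
    rw [sum_eq_add_add_sum_subtype (T := T) hij _ (fun l hl _ _ => by
      rw [x_eq_zero c k T j hl, zero_pow hk, mul_zero]), mul_zero, mul_add, ← mul_assoc,
      ← map_mul, hb, map_one, one_mul, x_self, one_pow, mul_one, map_zero] at h
    rw [← h]
    simp only [a, map_mul, map_add, map_sum, map_pow]
    rw [hC, hC]
    congr! 6 with l
    · exact hC _
    · exact hX l
  -- Images of the coordinates under the inverse map: free coordinates go to the variables, `xᵢ` to
  -- the adjoined root, `xⱼ` to `1` and those in `T` to `0`.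
  let w : Fin (n + 1) → P.Ring := fun l =>
    if h : l ∉ T ∧ l ≠ i ∧ l ≠ j then algebraMap A _ (X ⟨l, h⟩) else
      if l = i then P.X else if l = j then 1 else 0
  have hwi : w i = P.X := by simp [w]
  have hwj : w j = 1 := by simp [w, hij.symm]
  have hwT {l} (hl : l ∈ T) : w l = 0 := by
    have h1 : l ≠ i := fun h => hi (h ▸ hl)
    have h2 : l ≠ j := fun h => hj (h ▸ hl)
    simp [w, hl, h1, h2]
  have hw' (l : {l // l ∉ T ∧ l ≠ i ∧ l ≠ j}) : w l = algebraMap A _ (X l) := dif_pos l.2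
  let ev : MvPolynomial (Fin (n + 1)) R →+* P.Ring :=
    eval₂Hom ((algebraMap A P.Ring).comp C) w
  have hev : diagonalChartIdeal c k T j ≤ RingHom.ker ev := by
    refine Ideal.span_le.mpr ?_
    rintro _ (rfl | rfl | ⟨l, hl, rfl⟩)
    · simp [ev, hwj]
    · simp only [SetLike.mem_coe, RingHom.mem_ker, map_sum, map_mul, map_pow, ev, eval₂Hom_C,
        eval₂Hom_X', RingHom.comp_apply]
      rw [sum_eq_add_add_sum_subtype (T := T) hij _ (fun l hl _ _ => by
        rw [hwT hl, zero_pow hk, mul_zero]), hwi, hwj]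
      have h := congr(algebraMap A P.Ring (C (c i)) * $hPX)
      have hci : algebraMap A P.Ring (C (c i)) * algebraMap A P.Ring (C b) = 1 := by
        rw [← map_mul, ← C_mul, mul_comm, hb, C_1, map_one]
      rw [map_mul, mul_add, ← mul_assoc, hci, one_mul, mul_zero] at h
      rw [← h]
      simp [hw']
    · simpa [ev] using hwT hl
  let ψ₀ : DiagonalChart c k T j →+* P.Ring := lift ev hev
  have hψ₀ (l) : ψ₀ (x c k T j l) = w l := (lift_mk _ _ _).trans (eval₂Hom_X' _ _ _)
  have hψ₀C (r) : ψ₀ (algebraMap R _ r) = algebraMap A _ (C r) :=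
    (lift_mk _ hev _).trans (eval₂Hom_C _ _ _)
  let ψ : L →+* P.Ring := IsLocalization.Away.lift (x c k T j i) (g := ψ₀) (by
    rwa [hψ₀, hwi])
  have hψ (l) : ψ (algebraMap _ L l) = ψ₀ l := IsLocalization.Away.lift_eq _ _ _
  have hψA (y : A) : ψ (algebraMap A L y) = algebraMap A P.Ring y := by
    refine DFunLike.congr_fun (MvPolynomial.ringHom_ext (f := ψ.comp (algebraMap A L)) ?_ ?_) y
    · intro r
      rw [RingHom.comp_apply, hC, hψ, hψ₀C]
    · intro l
      rw [RingHom.comp_apply, hX, hψ, hψ₀, hw']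
  -- An `A`-endomorphism of `L` automatically fixes the scalars, the free coordinates, `xⱼ = 1` and
  -- the zero coordinates, so only `xᵢ` needs the assumption.
  refine P.etale_of_hasMap hP { ψ with commutes' := hψA } ((hψ _).trans ((hψ₀ i).trans hwi))
    fun f hf => AlgHom.coe_ringHom_injective (DiagonalChart.ringHom_ext (c := c) (k := k) (T := T) (j := j) i ?_ ?_)
  · intro r
    exact (congrArg f (hC r)).symm.trans ((f.commutes _).trans (hC r))
  · intro l
    by_cases h : l ∉ T ∧ l ≠ i ∧ l ≠ j
    · exact (congrArg f (hX ⟨l, h⟩)).symm.trans ((f.commutes _).trans (hX ⟨l, h⟩))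
    · rcases eq_or_ne l i with rfl | h₁
      · exact hf
      rcases eq_or_ne l j with rfl | h₂
      · rw [x_self, map_one, map_one, map_one]
      · have hl : l ∈ T := by tauto
        rw [x_eq_zero c k T j hl, map_zero, map_zero, map_zero]

variable {c k} in
-- The localized chart is étale, that is, of relative dimension `0`, over a polynomial ring in the
-- coordinates other than `i`, `j` and those in `T`; these number `(n + 1) - (#T + 2)`.
lemma DiagonalChart.isStandardSmoothOfRelativeDimension_away (hc : ∀ i, IsUnit (c i))
    (hk : k ≠ 0) (hu : IsUnit (k : R)) {T : Finset (Fin (n + 1))} {i j : Fin (n + 1)}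
    (hi : i ∉ T) (hj : j ∉ T) (hij : i ≠ j)
    (L : Type) [CommRing L] [Algebra (DiagonalChart c k T j) L]
    [IsLocalization.Away (x c k T j i) L] :
    ((algebraMap (DiagonalChart c k T j) L).comp (algebraMap R _)
      ).IsStandardSmoothOfRelativeDimension (n - 1 - T.card) := by
  let A := MvPolynomial {l // l ∉ (T : Set (Fin (n + 1))) ∧ l ≠ i ∧ l ≠ j} R
  obtain ⟨g, hgC, hgX⟩ : ∃ g : A →+* L,
      (∀ r, g (C r) = algebraMap (DiagonalChart c k T j) _ (algebraMap R _ r)) ∧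
      ∀ l, g (X l) = algebraMap (DiagonalChart c k T j) _ (x c k T j l) :=
    ⟨eval₂Hom ((algebraMap (DiagonalChart c k T j) L).comp (algebraMap R _))
      fun l => algebraMap (DiagonalChart c k T j) L (x c k T j l),
      eval₂Hom_C _ _, eval₂Hom_X' _ _⟩
  have hg : g.IsStandardSmoothOfRelativeDimension 0 := by
    algebraize [g]
    have := etale_of_isLocalization_away hc hk hu (T := T) hi hj hij L hgC hgX
    exact Algebra.Etale.iff_isStandardSmoothOfRelativeDimension_zero.mp this
  have hA : (algebraMap R A).IsStandardSmoothOfRelativeDimension (n - 1 - T.card) := by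
    rw [RingHom.isStandardSmoothOfRelativeDimension_algebraMap]
    convert MvPolynomial.isStandardSmoothOfRelativeDimension
      {l // l ∉ (T : Set (Fin (n + 1))) ∧ l ≠ i ∧ l ≠ j} R
    classical
    rw [Nat.card_eq_fintype_card, Fintype.card_subtype]
    have : (Finset.univ.filter fun l => l ∉ (T : Set (Fin (n + 1))) ∧ l ≠ i ∧ l ≠ j) =
        (insert i (insert j T))ᶜ := by
      ext l
      simp
      tauto
    rw [this, Finset.card_compl, Finset.card_insert_of_notMem (by simpa [hij] using hi),
      Finset.card_insert_of_notMem hj, Fintype.card_fin]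
    omega
  have h := hg.comp hA
  rw [zero_add] at h
  convert h using 1
  ext r
  exact (hgC r).symm

variable {c k} in
/-- An affine chart of the diagonal hypersurface, intersected with `#T` coordinate hyperplanes, is
smooth of relative dimension `n - 1 - #T`. -/
lemma DiagonalChart.locally_isStandardSmoothOfRelativeDimension (hc : ∀ i, IsUnit (c i))
    (hk : k ≠ 0) (hu : IsUnit (k : R)) (T : Finset (Fin (n + 1))) (j : Fin (n + 1)) :
    RingHom.Locally (RingHom.IsStandardSmoothOfRelativeDimension (n - 1 - T.card))
      (algebraMap R (DiagonalChart c k T j)) := by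
  by_cases hj : j ∈ T
  -- Here `1 = xⱼ = 0`, so the empty family generates the unit ideal and the local condition is
  -- vacuous.
  · refine ⟨∅, ?_, fun t ht => absurd ht (Set.notMem_empty t)⟩
    rw [Ideal.eq_top_iff_one, ← x_self c k (T : Set _) j, x_eq_zero c k (T : Set _) j hj]
    exact zero_mem _
  · have hf (i : {i // i ∉ (T : Set (Fin (n + 1))) ∧ i ≠ j}) :=
      isStandardSmoothOfRelativeDimension_away hc hk hu i.2.1 hj i.2.2
        (Localization.Away (x c k T j i))
    generalize n - 1 - T.card = d at hf ⊢
    have hs := span_range_x (T : Set (Fin (n + 1))) j hc hk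
    refine ⟨_, hs, fun t ht => ?_⟩
    obtain ⟨i, rfl⟩ := ht
    exact hf i

end Chart
end

/-! ### Comparison of the charts with the degree-zero localizations of the homogeneous coordinate
ring -/

noncomputable section

open MvPolynomial HomogeneousLocalization

attribute [local instance] MvPolynomial.gradedAlgebra

/-- With `s = 1 / xⱼ` this expresses the dehomogenization of a form through its values at the
original coordinates. -/
lemma MvPolynomial.IsHomogeneous.eval₂_mul_right {σ R S : Type*} [CommSemiring R] [CommSemiring S]
    {p : MvPolynomial σ R} {d : ℕ} (hp : p.IsHomogeneous d) (f : R →+* S) (g : σ → S) (s : S) :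
    p.eval₂ f (fun i => g i * s) = p.eval₂ f g * s ^ d := by
  rw [eval₂_eq, eval₂_eq, Finset.sum_mul]
  refine Finset.sum_congr rfl fun m hm => ?_
  have h := hp (mem_support_iff.mp hm)
  rw [Finsupp.weight_apply] at h
  simp only [mul_pow, Finset.prod_mul_distrib, ← h, Finset.prod_pow_eq_pow_sum, mul_assoc,
    Finsupp.sum, Pi.one_apply, smul_eq_mul, mul_one]

lemma Localization.Away.mk_pow_eq_mul_invSelf_pow {A : Type*} [CommRing A] (x a : A) (d : ℕ)
    (h : x ^ d ∈ Submonoid.powers x) :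
    (Localization.mk a ⟨x ^ d, h⟩ : Localization.Away x) =
      algebraMap A _ a * IsLocalization.Away.invSelf x ^ d := by
  rw [Localization.mk_eq_mk', IsLocalization.mk'_eq_iff_eq_mul, map_pow, mul_assoc, ← mul_pow,
    mul_comm _ (algebraMap A _ x), IsLocalization.Away.mul_invSelf, one_pow, mul_one]

variable {R : Type} [CommRing R] {n : ℕ}

section

variable (I : HomogeneousIdeal (homogeneousSubmodule (Fin (n + 1)) R))

/-- The coordinates on `Proj (R[x₀, …, xₙ] / I)`. -/
def projCoord (i : Fin (n + 1)) : MvPolynomial (Fin (n + 1)) R ⧸ I.toIdeal :=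
  Ideal.Quotient.mk _ (X i)

lemma projCoord_mem (i : Fin (n + 1)) : projCoord I i ∈ quotGrading I 1 :=
  mk_mem_quotGrading I (isHomogeneous_X R i)

/-- The structure map of the degree zero part of a homogeneous localization. -/
def awayBase (f : MvPolynomial (Fin (n + 1)) R ⧸ I.toIdeal) : R →+* Away (quotGrading I) f :=
  (fromZeroRingHom (quotGrading I) _).comp (algebraMap R (quotGrading I 0))

/-- Dehomogenization of polynomials. -/
def awayEval (j : Fin (n + 1)) :
    MvPolynomial (Fin (n + 1)) R →+* Away (quotGrading I) (projCoord I j) :=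
  eval₂Hom (awayBase I _)
    fun i => Away.mk _ (projCoord_mem I j) 1 (projCoord I i) (projCoord_mem I i)

variable {I} in
-- Substituting `xᵢ / xⱼ` in a form of degree `d` divides it by `xⱼᵈ`. The comparison is made in the
-- full localization, into which the degree-zero part embeds.
lemma awayEval_of_isHomogeneous (j : Fin (n + 1)) {p : MvPolynomial (Fin (n + 1)) R} {d : ℕ}
    (hp : p.IsHomogeneous d) :
    awayEval I j p = Away.mk _ (projCoord_mem I j) d (Ideal.Quotient.mk _ p)
      (by simpa using mk_mem_quotGrading I hp) := by
  refine val_injective _ ?_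
  let L := Localization.Away (projCoord I j)
  let ν := algebraMap (Away (quotGrading I) (projCoord I j)) L
  let s : L := IsLocalization.Away.invSelf (projCoord I j)
  have h : ν (awayEval I j p) = p.eval₂ ((algebraMap _ L).comp (Ideal.Quotient.mk I.toIdeal |>.comp C))
      (fun i => algebraMap _ L (projCoord I i) * s) := by
    change ν (eval₂ _ _ p) = _
    rw [eval₂_comp_left]
    congr 1
    ext i
    exact (Localization.Away.mk_pow_eq_mul_invSelf_pow _ _ 1 _).trans (congrArg _ (pow_one _))
  change ν _ = _
  rw [h, hp.eval₂_mul_right, Away.val_mk, Localization.Away.mk_pow_eq_mul_invSelf_pow]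
  congr 1
  have h' := eval₂_comp_left ((algebraMap _ L).comp (Ideal.Quotient.mk I.toIdeal)) C X p
  rw [eval₂_eta] at h'
  exact h'.symm

variable {I} in
lemma awayEval_C (j : Fin (n + 1)) (r : R) : awayEval I j (C r) = awayBase I _ r :=
  eval₂Hom_C _ _ _

lemma awayEval_X (j l : Fin (n + 1)) : awayEval I j (X l) =
    Away.mk _ (projCoord_mem I j) 1 (projCoord I l) (projCoord_mem I l) :=
  eval₂Hom_X' _ _ _

lemma awayEval_X_self (j : Fin (n + 1)) : awayEval I j (X j) = 1 := by
  rw [awayEval_X]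
  refine val_injective _ ?_
  rw [Away.val_mk, val_one, Localization.Away.mk_pow_eq_mul_invSelf_pow, pow_one,
    IsLocalization.Away.mul_invSelf]

lemma awayEval_surjective (j : Fin (n + 1)) : Function.Surjective (awayEval I j) := by
  intro z
  obtain ⟨d, _, ⟨p, hp, rfl⟩, rfl⟩ := Away.mk_surjective _ (projCoord_mem I j) z
  rw [smul_eq_mul, mul_one] at hp
  exact ⟨p, awayEval_of_isHomogeneous j hp⟩

variable {I} in
lemma awayEval_eq_zero {j : Fin (n + 1)} {p : MvPolynomial (Fin (n + 1)) R} {d : ℕ}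
    (hp : p.IsHomogeneous d) (hI : p ∈ I.toIdeal) : awayEval I j p = 0 := by
  rw [awayEval_of_isHomogeneous j hp]
  refine val_injective _ ?_
  rw [Away.val_mk, val_zero, Ideal.Quotient.eq_zero_iff_mem.mpr hI, Localization.mk_zero]

end

section

variable (c : Fin (n + 1) → R) (k : ℕ) (T : Set (Fin (n + 1))) (j : Fin (n + 1))

/-- The map from the dehomogenization to the homogeneous localization. -/
def chartHom : DiagonalChart c k T j →+*
    Away (quotGrading (diagonalIdeal c k T)) (projCoord (diagonalIdeal c k T) j) :=
  DiagonalChart.lift (awayEval (diagonalIdeal c k T) j) <| Ideal.span_le.mpr <| by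
    rintro _ (rfl | rfl | ⟨l, hl, rfl⟩)
    · simp [awayEval_X_self]
    · exact awayEval_eq_zero (d := k) (.sum _ _ _ fun i _ => isHomogeneous_C_mul_X_pow (c i) i k)
        (Ideal.subset_span (Set.mem_insert _ _))
    · exact awayEval_eq_zero (isHomogeneous_X R l)
        (Ideal.subset_span (Set.mem_insert_of_mem _ ⟨l, hl, rfl⟩))

lemma chartHom_mk (p : MvPolynomial (Fin (n + 1)) R) :
    chartHom c k T j (DiagonalChart.mk c k T j p) = awayEval (diagonalIdeal c k T) j p :=
  DiagonalChart.lift_mk _ _ _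

lemma diagonalIdeal_le_diagonalChartIdeal :
    (diagonalIdeal c k T).toIdeal ≤ diagonalChartIdeal c k T j :=
  Ideal.span_mono (Set.subset_insert _ _)

variable {c k T j} {f : MvPolynomial (Fin (n + 1)) R ⧸ (diagonalIdeal c k T).toIdeal}
  (hf : f = projCoord (diagonalIdeal c k T) j)

/-- Dehomogenization on the inhomogeneous localization. -/
def localizationToChart : Localization.Away f →+* DiagonalChart c k T j :=
  IsLocalization.Away.lift f
    (g := (Ideal.Quotient.factor (diagonalIdeal_le_diagonalChartIdeal c k T j) :
      _ →+* MvPolynomial (Fin (n + 1)) R ⧸ diagonalChartIdeal c k T j))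
    (hf ▸ isUnit_iff_exists_inv.mpr ⟨1, (mul_one _).trans (DiagonalChart.x_self c k T j)⟩)

lemma localizationToChart_algebraMap (p : MvPolynomial (Fin (n + 1)) R) :
    localizationToChart hf
      (algebraMap _ _ (Ideal.Quotient.mk (diagonalIdeal c k T).toIdeal p)) =
      DiagonalChart.mk c k T j p :=
  IsLocalization.Away.lift_eq _ _ _

lemma localizationToChart_invSelf :
    localizationToChart hf (IsLocalization.Away.invSelf f) = 1 := by
  subst hf
  have h := congr(localizationToChart rfl $(IsLocalization.Away.mul_invSelf
    (S := Localization.Away (projCoord (diagonalIdeal c k T) j))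
    (projCoord (diagonalIdeal c k T) j)))
  have h' : localizationToChart rfl (algebraMap _ _ (projCoord (diagonalIdeal c k T) j)) = 1 :=
    (localizationToChart_algebraMap rfl (X j)).trans (DiagonalChart.x_self c k T j)
  rwa [map_mul, map_one, h', one_mul] at h

/-- Dehomogenization of homogeneous fractions. -/
def awayToChart : Away (quotGrading (diagonalIdeal c k T)) f →+* DiagonalChart c k T j :=
  (localizationToChart hf).comp (algebraMap _ (Localization.Away f))

lemma awayToChart_mk {e : ℕ} (h : f ∈ quotGrading (diagonalIdeal c k T) e) (d : ℕ)
    {a : MvPolynomial (Fin (n + 1)) R ⧸ (diagonalIdeal c k T).toIdeal}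
    (ha : a ∈ quotGrading (diagonalIdeal c k T) (d • e)) {p : MvPolynomial (Fin (n + 1)) R}
    (hp : a = Ideal.Quotient.mk _ p) :
    awayToChart hf (Away.mk _ h d a ha) = DiagonalChart.mk c k T j p := by
  subst hp
  rw [awayToChart, RingHom.comp_apply, HomogeneousLocalization.algebraMap_apply, Away.val_mk,
    Localization.Away.mk_pow_eq_mul_invSelf_pow, map_mul, map_pow, localizationToChart_invSelf,
    one_pow, mul_one, localizationToChart_algebraMap]

lemma awayToChart_awayBase (r : R) :
    awayToChart hf (awayBase _ f r) = algebraMap R (DiagonalChart c k T j) r :=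
  localizationToChart_algebraMap hf (C r)

lemma awayToChart_chartHom (z : DiagonalChart c k T j) :
    awayToChart rfl (chartHom c k T j z) = z := by
  refine RingHom.congr_fun (f := (awayToChart rfl).comp (chartHom c k T j))
    (g := RingHom.id _) (DiagonalChart.hom_ext ?_ ?_) z
  · intro r
    rw [RingHom.comp_apply, ← DiagonalChart.mk_C, chartHom_mk, awayEval_C]
    exact awayToChart_awayBase rfl r
  · intro l
    rw [RingHom.comp_apply, ← DiagonalChart.mk_X, chartHom_mk, awayEval_X]
    exact awayToChart_mk rfl _ _ _ rfl

/-- Injectivity comes from the retraction `awayToChart`; surjectivity holds because each homogeneous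
fraction is `p / xⱼᵈ` for a form `p`. -/
lemma chartHom_bijective : Function.Bijective (chartHom c k T j) :=
  ⟨Function.LeftInverse.injective awayToChart_chartHom, fun z => by
      obtain ⟨p, rfl⟩ := awayEval_surjective _ j z
      exact ⟨_, chartHom_mk c k T j p⟩⟩

lemma awayToChart_bijective : Function.Bijective (awayToChart hf) := by
  subst hf
  have h : Function.LeftInverse (awayToChart rfl) (chartHom c k T j) := awayToChart_chartHom
  exact ⟨(h.rightInverse_of_surjective chartHom_bijective.2).injective, h.surjective⟩

section Functoriality

variable {R' : Type} [CommRing R'] {c' : Fin (n + 1) → R'} {T' : Set (Fin (n + 1))}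
  (σ : R →+* R')

/-- Functoriality of the coordinate rings of the affine charts in the base and in the set of
coordinate hyperplanes. -/
def DiagonalChart.map (hc : ∀ i, σ (c i) = c' i) (hT : T ⊆ T') :
    DiagonalChart c k T j →+* DiagonalChart c' k T' j :=
  lift ((mk c' k T' j).comp (MvPolynomial.map σ)) <| Ideal.span_le.mpr <| by
    rintro _ (rfl | rfl | ⟨l, hl, rfl⟩)
    · simp [mk_X, x_self]
    · have h := sum_eq_zero c' k T' j
      simpa [mk_X, mk_C, hc] using h
    · simpa [mk_X] using x_eq_zero c' k T' j (hT hl)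

variable {σ} in
lemma DiagonalChart.map_mk (hc : ∀ i, σ (c i) = c' i) (hT : T ⊆ T')
    (p : MvPolynomial (Fin (n + 1)) R) :
    map (k := k) (j := j) σ hc hT (mk c k T j p) = mk c' k T' j (MvPolynomial.map σ p) :=
  lift_mk _ _ _

variable {σ} in
-- `Away.map G f` lands in the localization at `G f`, which is a coordinate only up to a
-- propositional equality. This is why the charts allow any `f` with a proof that it equals the
-- coordinate.
lemma awayToChart_comp_map (hc : ∀ i, σ (c i) = c' i) (hT : T ⊆ T')
    (G : quotGrading (diagonalIdeal c k T) →+*ᵍ quotGrading (diagonalIdeal c' k T'))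
    (hG : ∀ p, G (Ideal.Quotient.mk _ p) = Ideal.Quotient.mk _ (MvPolynomial.map σ p))
    (hGf : G f = projCoord (diagonalIdeal c' k T') j) :
    (awayToChart hGf).comp (Away.map G f) =
      (DiagonalChart.map σ hc hT).comp (awayToChart hf) := by
  ext z
  obtain ⟨d, a, ha, rfl⟩ := Away.mk_surjective _ (hf ▸ projCoord_mem _ j) z
  obtain ⟨p, rfl⟩ := Ideal.Quotient.mk_surjective a
  rw [RingHom.comp_apply, RingHom.comp_apply, Away.map_mk, awayToChart_mk hf _ _ _ rfl,
    awayToChart_mk hGf _ _ _ (hG p), DiagonalChart.map_mk]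

end Functoriality

end
end

/-! ### The affine cover of `Proj` and its functoriality -/

noncomputable section

open MvPolynomial HomogeneousLocalization

attribute [local instance] MvPolynomial.gradedAlgebra

variable {R : Type} [CommRing R] {n : ℕ}

/-- A form of positive degree has no constant term, so it lies in the ideal of the variables.
Consequently the loci `xⱼ ≠ 0` cover `Proj`. -/
lemma irrelevant_le_span_projCoord
    (I : HomogeneousIdeal (homogeneousSubmodule (Fin (n + 1)) R)) :
    (HomogeneousIdeal.irrelevant (quotGrading I)).toIdeal ≤
      Ideal.span (Set.range (projCoord I)) := by
  rw [HomogeneousIdeal.toIdeal_irrelevant_le]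
  rintro i hi _ ⟨p, hp, rfl⟩
  have h : p ∈ Ideal.span (X '' (Set.univ : Set (Fin (n + 1)))) := by
    rw [mem_ideal_span_X_image]
    intro m hm
    by_contra! h
    have h' := hp (mem_support_iff.mp hm)
    obtain rfl : m = 0 := by
      ext l
      exact h l (Set.mem_univ l)
    rw [map_zero] at h'
    exact hi.ne h'
  have h' := Ideal.mem_map_of_mem (Ideal.Quotient.mk I.toIdeal) h
  rw [Ideal.map_span, Set.image_univ, ← Set.range_comp] at h'
  exact h'

variable {c : Fin (n + 1) → R} {k : ℕ} {T : Set (Fin (n + 1))} {j : Fin (n + 1)}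

section
variable {f : MvPolynomial (Fin (n + 1)) R ⧸ (diagonalIdeal c k T).toIdeal}
  (hf : f = projCoord (diagonalIdeal c k T) j)

/-- The affine charts `xⱼ = 1` of `Proj`. -/
def chartι : Spec (.of (DiagonalChart c k T j)) ⟶ projZeroLocus (diagonalIdeal c k T) :=
  Spec.map (CommRingCat.ofHom (awayToChart hf)) ≫
    Proj.awayι (quotGrading (diagonalIdeal c k T)) f (hf ▸ projCoord_mem _ j) one_pos

lemma isIso_SpecMap_awayToChart : IsIso (Spec.map (CommRingCat.ofHom (awayToChart hf))) := by
  have : IsIso (CommRingCat.ofHom (awayToChart hf)) :=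
    (RingEquiv.ofBijective _ (awayToChart_bijective hf)).toCommRingCatIso.isIso_hom
  infer_instance

instance isOpenImmersion_chartι : IsOpenImmersion (chartι hf) := by
  have := isIso_SpecMap_awayToChart hf
  exact @IsOpenImmersion.comp _ _ _ _ (Proj.awayι (quotGrading (diagonalIdeal c k T)) f _ _) _
    inferInstance

lemma opensRange_chartι :
    (chartι hf).opensRange = Proj.basicOpen (quotGrading (diagonalIdeal c k T)) f := by
  have := isIso_SpecMap_awayToChart hf
  exact (Scheme.Hom.opensRange_comp_of_isIso (Y := Spec _) (Z := Proj _) _ _).trans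
    (Proj.opensRange_awayι _ _ _ _)

lemma chartι_toSpec : chartι hf ≫ projZeroLocus.toSpec (diagonalIdeal c k T) =
    Spec.map (CommRingCat.ofHom (algebraMap R (DiagonalChart c k T j))) := by
  change (Spec.map _ ≫ Proj.awayι (quotGrading (diagonalIdeal c k T)) f _ _) ≫
    Proj.toSpecZero (quotGrading (diagonalIdeal c k T)) ≫ Spec.map _ = _
  rw [Category.assoc, Proj.awayι_toSpecZero_assoc, ← Spec.map_comp, ← Spec.map_comp]
  congr 1
  ext r
  exact awayToChart_awayBase hf r

end

variable (c k T) in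
/-- The covering by the affine charts. -/
def chartCover : (projZeroLocus (diagonalIdeal c k T)).OpenCover :=
  Scheme.Cover.mkOfCovers (Fin (n + 1)) (fun j => Spec (.of (DiagonalChart c k T j)))
    (fun j => chartι rfl) (fun x => by
      have h := Proj.iSup_basicOpen_eq_top _ _ (irrelevant_le_span_projCoord (diagonalIdeal c k T))
      obtain ⟨j, hj⟩ := TopologicalSpace.Opens.mem_iSup.mp (h.ge (TopologicalSpace.Opens.mem_top x))
      rw [← opensRange_chartι rfl] at hj
      obtain ⟨y, hy⟩ := hj
      exact ⟨j, y, hy⟩)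

section Functoriality

variable {R' : Type} [CommRing R'] {c' : Fin (n + 1) → R'} {T' : Set (Fin (n + 1))}
  {σ : R →+* R'} (hc : ∀ i, σ (c i) = c' i) (hT : T ⊆ T')
  (G : quotGrading (diagonalIdeal c k T) →+*ᵍ quotGrading (diagonalIdeal c' k T'))
  (hG : ∀ p, G (Ideal.Quotient.mk _ p) = Ideal.Quotient.mk _ (MvPolynomial.map σ p))
  (hG' : HomogeneousIdeal.irrelevant (quotGrading (diagonalIdeal c' k T')) ≤
      (HomogeneousIdeal.irrelevant (quotGrading (diagonalIdeal c k T))).map G)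
  {g : projZeroLocus (diagonalIdeal c' k T') ⟶ projZeroLocus (diagonalIdeal c k T)}
  (hg : g = Proj.map G hG')

include hG hg

lemma chartι_comp {f : MvPolynomial (Fin (n + 1)) R ⧸ (diagonalIdeal c k T).toIdeal}
    (hf : f = projCoord (diagonalIdeal c k T) j)
    (hGf : G f = projCoord (diagonalIdeal c' k T') j) :
    chartι hGf ≫ g = Spec.map (CommRingCat.ofHom (DiagonalChart.map σ hc hT)) ≫ chartι hf := by
  subst hg
  change (Spec.map _ ≫ Proj.awayι (quotGrading (diagonalIdeal c' k T')) _ _ _) ≫ Proj.map G _ =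
    Spec.map _ ≫ Spec.map _ ≫ Proj.awayι (quotGrading (diagonalIdeal c k T)) _ _ _
  rw [Category.assoc, Proj.awayι_comp_map G hG' one_pos f (hf ▸ projCoord_mem _ j),
    ← Spec.map_comp_assoc, ← Spec.map_comp_assoc]
  congr 2
  ext : 1
  exact awayToChart_comp_map hf hc hT G hG hGf

/-- The preimage of the locus `xⱼ ≠ 0` is again the locus `xⱼ ≠ 0`, and a commutative square with
open immersions of matching ranges is Cartesian. The inclusions `T ⊆ T'` and the change of base ring
are both instances. -/
lemma isPullback_chartι (j : Fin (n + 1)) :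
    IsPullback (chartι (c := c') (k := k) (T := T') (j := j) rfl)
      (Spec.map (CommRingCat.ofHom (DiagonalChart.map σ hc hT))) g (chartι rfl) := by
  have hGf : G (projCoord (diagonalIdeal c k T) j) = projCoord (diagonalIdeal c' k T') j := by
    rw [projCoord, hG, map_X, projCoord]
  have h (f) (hf : f = projCoord (diagonalIdeal c' k T') j) :
      chartι hf = chartι (c := c') (k := k) (T := T') (j := j) rfl := by
    subst hf
    rfl
  have w := chartι_comp hc hT G hG hG' hg rfl hGf
  rw [h] at w
  refine (IsOpenImmersion.isPullback _ _ _ _ w ?_).flip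
  rw [opensRange_chartι, opensRange_chartι]
  subst hg
  exact (Proj.map_preimage_basicOpen _ _ _).trans (congrArg _ hGf)

end Functoriality

end

/-! ### Ideal sheaves and the intersections of coordinate divisors -/

noncomputable section

namespace AlgebraicGeometry

open Limits

namespace Scheme.IdealSheafData

/-- Ideal sheaves on `Spec A` correspond to ideals of `A`. -/
def specOrderIso (A : CommRingCat.{0}) : (Spec A).IdealSheafData ≃o Ideal A :=
  OrderIso.trans (equivOfIsAffine (X := Spec A) : (Spec A).IdealSheafData ≃o Ideal Γ(Spec A, ⊤))
    (Scheme.ΓSpecIso A).symm.commRingCatIsoToRingEquiv.idealComapOrderIso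

lemma specOrderIso_ker {A B : CommRingCat.{0}} (φ : A ⟶ B) :
    specOrderIso A (Spec.map φ).ker = RingHom.ker φ.hom := by
  rw [ker_of_isAffine]
  ext x
  have h : (Spec.map φ).appTop.hom ((Scheme.ΓSpecIso A).inv.hom x) =
    (Scheme.ΓSpecIso B).inv.hom (φ.hom x) := congr($(Scheme.ΓSpecIso_inv_naturality φ) x).symm
  have h' : x ∈ specOrderIso A (ofIdealTop (RingHom.ker (Spec.map φ).appTop.hom)) ↔
      (Scheme.ΓSpecIso A).inv.hom x ∈ (ofIdealTop (RingHom.ker (Spec.map φ).appTop.hom)).ideal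
        ⟨⊤, isAffineOpen_top (Spec A)⟩ := Iff.rfl
  have h'' : (ofIdealTop (RingHom.ker (Spec.map φ).appTop.hom)).ideal
      ⟨⊤, isAffineOpen_top (Spec A)⟩ = RingHom.ker (Spec.map φ).appTop.hom :=
    (equivOfIsAffine (X := Spec A)).apply_symm_apply _
  rw [h', h'', RingHom.mem_ker, h, RingHom.mem_ker]
  exact map_eq_zero_iff _ (ConcreteCategory.bijective_of_isIso (Scheme.ΓSpecIso B).inv).injective

lemma comap_ker_of_isPullback {P X Y Z : Scheme.{0}} {fst : P ⟶ X} {snd : P ⟶ Y} {f : X ⟶ Z}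
    {g : Y ⟶ Z} [IsClosedImmersion g] (h : IsPullback fst snd f g) :
    g.ker.comap f = fst.ker := by
  rw [← ker_fst_of_isClosedImmersion, ← h.isoPullback_hom_fst, Hom.ker_comp_of_isIso]

lemma ext_of_openCover {X : Scheme.{0}} {I J : X.IdealSheafData} (𝒰 : X.OpenCover)
    [∀ i, IsAffine (𝒰.X i)] (h : ∀ i, I.comap (𝒰.f i) = J.comap (𝒰.f i)) : I = J := by
  refine ext_of_iSup_eq_top (fun i => ⟨_, isAffineOpen_opensRange (𝒰.f i)⟩)
    (𝒰.iSup_opensRange) fun i => ?_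
  have h' := congr(($(h i)).ideal ⟨⊤, isAffineOpen_top _⟩)
  rw [ideal_comap_of_isOpenImmersion, ideal_comap_of_isOpenImmersion] at h'
  have h'' := Ideal.comap_injective_of_surjective _
    (ConcreteCategory.bijective_of_isIso ((𝒰.f i).appIso ⊤).inv).surjective h'
  have e : (⟨_, isAffineOpen_opensRange (𝒰.f i)⟩ : X.affineOpens) =
      ⟨𝒰.f i ''ᵁ ⊤, (isAffineOpen_top _).image_of_isOpenImmersion _⟩ :=
    Subtype.ext (Scheme.Hom.image_top_eq_opensRange _).symm
  rw [e]
  exact h''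

lemma comap_finset_sup {X Y : Scheme.{0}} {ι : Type*} (s : Finset ι) (I : ι → Y.IdealSheafData)
    (f : X ⟶ Y) : (s.sup I).comap f = s.sup fun i => (I i).comap f :=
by
  induction s using Finset.cons_induction with
  | empty => exact comap_bot f
  | cons i s _ h => rw [Finset.sup_cons, Finset.sup_cons, comap_sup, h]

end Scheme.IdealSheafData

end AlgebraicGeometry

open MvPolynomial

attribute [local instance] MvPolynomial.gradedAlgebra

variable {R : Type} [CommRing R] {n : ℕ} {c : Fin (n + 1) → R} {k : ℕ}
  {T T' : Set (Fin (n + 1))} {j : Fin (n + 1)}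

namespace DiagonalChart

/-- The quotient map cutting out further coordinate hyperplanes. -/
def factor (h : T ⊆ T') : DiagonalChart c k T j →+* DiagonalChart c k T' j :=
  map (RingHom.id R) (fun _ => rfl) h

lemma factor_mk (h : T ⊆ T') (p : MvPolynomial (Fin (n + 1)) R) :
    factor h (mk c k T j p) = mk c k T' j p := by
  rw [factor, map_mk, MvPolynomial.map_id]

lemma factor_surjective (h : T ⊆ T') :
    Function.Surjective (factor h : DiagonalChart c k T j →+* _) := by
  intro z
  obtain ⟨p, rfl⟩ := mk_surjective _ _ _ _ z
  exact ⟨mk _ _ _ _ p, factor_mk h p⟩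

/-- Of the relations defining the smaller chart, `xⱼ = 1` and the diagonal equation already hold in
the larger one, so only the new coordinates contribute. -/
lemma ker_factor (h : T ⊆ T') : RingHom.ker (factor h : DiagonalChart c k T j →+* _) =
      Ideal.span (x c k T j '' T') := by
  have h1 : RingHom.ker (factor h : DiagonalChart c k T j →+* _) =
      (diagonalChartIdeal c k T' j).map (mk c k T j) := by
    ext z
    obtain ⟨p, rfl⟩ := mk_surjective _ _ _ _ z
    rw [RingHom.mem_ker, factor_mk, mk_eq_zero_iff,
      Ideal.mem_map_iff_of_surjective _ (mk_surjective _ _ _ _)]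
    refine ⟨fun hp => ⟨p, hp, rfl⟩, ?_⟩
    rintro ⟨q, hq, hqp⟩
    rw [← sub_eq_zero, ← map_sub, mk_eq_zero_iff] at hqp
    have hle : diagonalChartIdeal c k T j ≤ diagonalChartIdeal c k T' j :=
      Ideal.span_mono (Set.insert_subset_insert (Set.insert_subset_insert (Set.image_mono h)))
    have := sub_mem hq (hle hqp)
    rwa [sub_sub_cancel] at this
  rw [h1, diagonalChartIdeal, Ideal.map_span, Set.image_insert_eq, Set.image_insert_eq,
    ← Set.image_comp]
  have h2 : mk c k T j (X j - 1) = 0 := by rw [map_sub, map_one, mk_X, x_self, sub_self]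
  have h3 : mk c k T j (∑ i, C (c i) * X i ^ k) = 0 := by
    simpa [mk_X, mk_C] using sum_eq_zero c k T j
  rw [h2, h3, Set.insert_idem, Ideal.span_insert_zero]
  rfl

lemma ker_factor_finset (J : Finset (Fin (n + 1))) :
    RingHom.ker (factor (Set.empty_subset J) : DiagonalChart c k ∅ j →+* _) =
      J.sup fun i => RingHom.ker (factor (Set.empty_subset {i}) : DiagonalChart c k ∅ j →+* _) := by
  simp only [ker_factor, Set.image_singleton]
  refine le_antisymm (Ideal.span_le.mpr ?_) (Finset.sup_le fun i hi => ?_)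
  · rintro _ ⟨i, hi, rfl⟩
    exact Finset.le_sup (f := fun i => Ideal.span {x c k ∅ j i}) hi
      (Ideal.mem_span_singleton_self _)
  · exact Ideal.span_mono (Set.singleton_subset_iff.mpr ⟨i, hi, rfl⟩)

end DiagonalChart

instance isAffine_chartCover (j : (chartCover c k T).I₀) : IsAffine ((chartCover c k T).X j) :=
  have (j : Fin (n + 1)) : IsAffine (Spec (.of (DiagonalChart c k T j))) := inferInstance
  this j

namespace projZeroLocus

lemma quotGradingFactor_diagonalIdeal_mk (h : T ⊆ T') (p : MvPolynomial (Fin (n + 1)) R) :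
    quotGradingFactor (diagonalIdeal_mono c k h) (Ideal.Quotient.mk _ p) =
      Ideal.Quotient.mk _ (MvPolynomial.map (RingHom.id R) p) := by
  rw [MvPolynomial.map_id]
  rfl

lemma incl_eq (h : T ⊆ T') : incl (diagonalIdeal_mono c k h) =
    Proj.map (quotGradingFactor (diagonalIdeal_mono c k h))
      (irrelevant_le_map_quotGradingFactor (diagonalIdeal_mono c k h)) := rfl

lemma isPullback_incl (h : T ⊆ T') (j : Fin (n + 1)) :
    IsPullback (chartι (c := c) (k := k) (T := T') (j := j) rfl)
      (Spec.map (CommRingCat.ofHom (DiagonalChart.factor h)))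
      (incl (diagonalIdeal_mono c k h)) (chartι rfl) := by
  have hc (i) : RingHom.id R (c i) = c i := rfl
  exact isPullback_chartι (c := c) (c' := c) (T := T) (T' := T') (σ := RingHom.id R) (k := k)
    hc h (quotGradingFactor (diagonalIdeal_mono c k h))
    (quotGradingFactor_diagonalIdeal_mk h)
    (irrelevant_le_map_quotGradingFactor (diagonalIdeal_mono c k h)) (incl_eq h) j

instance isClosedImmersion_incl (h : T ⊆ T') :
    IsClosedImmersion (incl (diagonalIdeal_mono c k h)) := by
  refine IsZariskiLocalAtTarget.of_openCover (chartCover c k T) fun (j : Fin (n + 1)) => ?_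
  have hp := isPullback_incl (c := c) (k := k) h j
  have h1 : IsClosedImmersion (Spec.map (CommRingCat.ofHom
      (DiagonalChart.factor h : DiagonalChart c k T j →+* _))) :=
    IsClosedImmersion.spec_of_surjective _ (DiagonalChart.factor_surjective h)
  rw [← hp.isoPullback_hom_snd, MorphismProperty.cancel_left_of_respectsIso @IsClosedImmersion]
    at h1
  exact h1

lemma incl_toSpec (h : T ⊆ T') :
    incl (diagonalIdeal_mono c k h) ≫ toSpec (diagonalIdeal c k T) =
      toSpec (diagonalIdeal c k T') := by
  refine (chartCover c k T').hom_ext _ _ fun (j : Fin (n + 1)) => ?_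
  change chartι (c := c) (k := k) (T := T') (j := j) rfl ≫ incl (diagonalIdeal_mono c k h) ≫
    toSpec (diagonalIdeal c k T) = chartι rfl ≫ toSpec (diagonalIdeal c k T')
  rw [(isPullback_incl h j).w_assoc, chartι_toSpec, chartι_toSpec, ← Spec.map_comp]
  congr 1
  ext r
  exact DiagonalChart.factor_mk h (C r)

lemma comap_ker_incl (h : T ⊆ T') (j : Fin (n + 1)) :
    (incl (diagonalIdeal_mono c k h)).ker.comap (chartι rfl) =
      (Spec.map (CommRingCat.ofHom (DiagonalChart.factor h :
        DiagonalChart c k T j →+* DiagonalChart c k T' j))).ker := by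
  have := isClosedImmersion_incl (c := c) (k := k) h
  exact Scheme.IdealSheafData.comap_ker_of_isPullback (isPullback_incl h j).flip

/-- This identifies the intersection of the divisors with a single `Proj`. Equality of ideal sheaves
is tested on the charts, where the ideal generated by the `xᵢ` with `i ∈ J` is the sum of the
principal ideals. -/
lemma ker_incl_finset (J : Finset (Fin (n + 1))) :
    (incl (diagonalIdeal_mono c k (Set.empty_subset (J : Set (Fin (n + 1)))))).ker =
      J.sup fun i => (incl (diagonalIdeal_mono c k (Set.empty_subset {i}))).ker := by
  refine Scheme.IdealSheafData.ext_of_openCover (chartCover c k ∅) fun (j : Fin (n + 1)) => ?_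
  change Scheme.IdealSheafData.comap _ (chartι (c := c) (k := k) (T := ∅) (j := j) rfl) =
    Scheme.IdealSheafData.comap _ (chartι rfl)
  rw [Scheme.IdealSheafData.comap_finset_sup, comap_ker_incl (Set.empty_subset _) j]
  refine Eq.trans ?_ (Finset.sup_congr rfl fun i _ =>
    (comap_ker_incl (Set.empty_subset {i}) j).symm)
  apply (Scheme.IdealSheafData.specOrderIso (.of (DiagonalChart c k ∅ j))).injective
  rw [map_finset_sup]
  refine (Scheme.IdealSheafData.specOrderIso_ker _).trans ((DiagonalChart.ker_factor_finset J).trans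
    (Finset.sup_congr rfl fun i _ => (Scheme.IdealSheafData.specOrderIso_ker
      (CommRingCat.ofHom (DiagonalChart.factor (Set.empty_subset {i})))).symm))

end projZeroLocus

end

/-! ### Smoothness of the pair -/

noncomputable section

open MvPolynomial

attribute [local instance] MvPolynomial.gradedAlgebra

variable {R : Type} [CommRing R] {n : ℕ} {c : Fin (n + 1) → R} {k : ℕ}

lemma isIso_toImage {X Y : Scheme.{0}} (f : X ⟶ Y) [IsClosedImmersion f] : IsIso f.toImage :=
  inferInstance

namespace projZeroLocus

lemma smoothOfRelativeDimension_toSpec (hc : ∀ i, IsUnit (c i)) (hk : k ≠ 0)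
    (hu : IsUnit (k : R)) (J : Finset (Fin (n + 1))) :
    SmoothOfRelativeDimension (n - 1 - J.card) (toSpec (diagonalIdeal c k J)) := by
  have : IsZariskiLocalAtSource (@SmoothOfRelativeDimension.{0} (n - 1 - J.card)) :=
    HasRingHomProperty.instIsZariskiLocalAtSource (P := @SmoothOfRelativeDimension.{0} _)
      (Q := RingHom.Locally (RingHom.IsStandardSmoothOfRelativeDimension (n - 1 - J.card)))
  refine IsZariskiLocalAtSource.of_openCover (P := @SmoothOfRelativeDimension (n - 1 - J.card))
    (chartCover c k J) fun (j : Fin (n + 1)) => ?_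
  change SmoothOfRelativeDimension _
    (chartι (c := c) (k := k) (T := J) (j := j) rfl ≫ toSpec (diagonalIdeal c k J))
  rw [chartι_toSpec, HasRingHomProperty.Spec_iff (P := @SmoothOfRelativeDimension _)]
  exact DiagonalChart.locally_isStandardSmoothOfRelativeDimension hc hk hu J j

lemma isEmpty_of_le_card (hc : ∀ i, IsUnit (c i)) (hk : k ≠ 0) {J : Finset (Fin (n + 1))}
    (hJ : n ≤ J.card) : IsEmpty (projZeroLocus (diagonalIdeal c k J)) := by
  refine ⟨fun x => ?_⟩
  obtain ⟨j, y, -⟩ : ∃ j : Fin (n + 1), ∃ y : PrimeSpectrum (DiagonalChart c k J j), chartι rfl y = x :=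
    (chartCover c k J).exists_eq x
  have : Subsingleton (DiagonalChart c k J j) := DiagonalChart.subsingleton_of_le_card j hc hk hJ
  have : IsEmpty (PrimeSpectrum (DiagonalChart c k J j)) := inferInstance
  exact this.elim y

end projZeroLocus

lemma diagonalPair_inter (m : Fin (n + 1) → ℕ) (J : Finset (Fin (n + 1))) :
    (diagonalPair R c k m).inter J = (projZeroLocus.incl
      (diagonalIdeal_mono c k (Set.empty_subset (J : Set (Fin (n + 1)))))).ker :=
  (projZeroLocus.ker_incl_finset J).symm

/-- A closed immersion is isomorphic to the inclusion of the subscheme defined by its kernel, so the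
chart computations transfer to the intersections. -/
lemma diagonalPair_subschemeι_str (m : Fin (n + 1) → ℕ) (J : Finset (Fin (n + 1))) :
    ∃ e : projZeroLocus (diagonalIdeal c k J) ≅ ((diagonalPair R c k m).inter J).subscheme,
      projZeroLocus.toSpec (diagonalIdeal c k J) =
        e.hom ≫ ((diagonalPair R c k m).inter J).subschemeι ≫ (diagonalPair R c k m).str := by
  have := projZeroLocus.isClosedImmersion_incl (c := c) (k := k)
    (Set.empty_subset (J : Set (Fin (n + 1))))
  have : IsIso (Scheme.Hom.toImage (projZeroLocus.incl
      (diagonalIdeal_mono c k (Set.empty_subset (J : Set (Fin (n + 1))))))) := isIso_toImage _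
  rw [diagonalPair_inter]
  refine ⟨@asIso _ _ _ _ _ this, ?_⟩
  rw [← projZeroLocus.incl_toSpec (Set.empty_subset (J : Set (Fin (n + 1))))]
  exact (Scheme.Hom.toImage_imageι_assoc _ _).symm

lemma diagonalPair_isSmoothPair (hc : ∀ i, IsUnit (c i)) (hk : k ≠ 0) (hu : IsUnit (k : R))
    (hn : 1 ≤ n) (m : Fin (n + 1) → ℕ) : (diagonalPair R c k m).IsSmoothPair (n - 1) := by
  intro J
  obtain ⟨e, he⟩ := diagonalPair_subschemeι_str (c := c) (k := k) m J
  refine ⟨fun _ => ?_, fun hJ => ?_⟩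
  · have h := projZeroLocus.smoothOfRelativeDimension_toSpec hc hk hu J
    have : IsZariskiLocalAtSource (@SmoothOfRelativeDimension.{0} (n - 1 - J.card)) :=
      HasRingHomProperty.instIsZariskiLocalAtSource (P := @SmoothOfRelativeDimension.{0} _)
        (Q := RingHom.Locally (RingHom.IsStandardSmoothOfRelativeDimension (n - 1 - J.card)))
    rw [he] at h
    have := this.toRespects
    exact (MorphismProperty.cancel_left_of_respectsIso
      (@SmoothOfRelativeDimension.{0} (n - 1 - J.card)) e.hom _).mp h
  · have := projZeroLocus.isEmpty_of_le_card hc hk (J := J) (by omega)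
    exact Function.isEmpty e.inv

lemma diagonalPair_smooth (hc : ∀ i, IsUnit (c i)) (hk : k ≠ 0) (hu : IsUnit (k : R))
    (m : Fin (n + 1) → ℕ) : Smooth (diagonalPair R c k m).str := by
  have h := projZeroLocus.smoothOfRelativeDimension_toSpec hc hk hu ∅
  rw [Finset.coe_empty] at h
  exact h.smooth

lemma projZeroLocus.smooth_toSpec (hc : ∀ i, IsUnit (c i)) (hk : k ≠ 0)
    (hu : IsUnit (k : R)) (T : Set (Fin (n + 1))) :
    Smooth (toSpec (diagonalIdeal c k T)) := by
  obtain ⟨J, rfl⟩ := T.toFinite.exists_finset_coe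
  have := smoothOfRelativeDimension_toSpec hc hk hu J
  exact SmoothOfRelativeDimension.smooth (n - 1 - J.card) _

end

/-! ### Change of base ring -/

noncomputable section

open MvPolynomial

attribute [local instance] MvPolynomial.gradedAlgebra

variable {R R' : Type} [CommRing R] [CommRing R'] {n : ℕ} {σ : R →+* R'}
  {c : Fin (n + 1) → R} {c' : Fin (n + 1) → R'} {k : ℕ}

lemma diagonalIdeal_le_comap_map (hc : ∀ i, σ (c i) = c' i) (T : Set (Fin (n + 1))) :
    (diagonalIdeal c k T).toIdeal ≤ (diagonalIdeal c' k T).toIdeal.comap (MvPolynomial.map σ) := by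
  refine Ideal.span_le.mpr ?_
  rintro _ (rfl | ⟨l, hl, rfl⟩)
  · refine Ideal.subset_span (Set.mem_insert_iff.mpr (Or.inl ?_))
    simp [hc]
  · refine Ideal.subset_span (Set.mem_insert_iff.mpr (Or.inr ⟨l, hl, ?_⟩))
    simp

/-- The graded homomorphism of homogeneous coordinate rings induced by a change of base ring. -/
def quotGradingMap (hc : ∀ i, σ (c i) = c' i) (k : ℕ) (T : Set (Fin (n + 1))) :
    quotGrading (diagonalIdeal c k T) →+*ᵍ quotGrading (diagonalIdeal c' k T) where
  __ := Ideal.quotientMap (diagonalIdeal c' k T).toIdeal (MvPolynomial.map σ)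
    (diagonalIdeal_le_comap_map hc T)
  map_mem := by
    rintro i _ ⟨a, ha, rfl⟩
    exact mk_mem_quotGrading (diagonalIdeal c' k T)
      (MvPolynomial.IsHomogeneous.map (f := σ) ha)

lemma quotGradingMap_mk (hc : ∀ i, σ (c i) = c' i) (T : Set (Fin (n + 1)))
    (p : MvPolynomial (Fin (n + 1)) R) :
    quotGradingMap hc k T (Ideal.Quotient.mk _ p) =
      Ideal.Quotient.mk _ (MvPolynomial.map σ p) := rfl

lemma irrelevant_le_map_quotGradingMap (hc : ∀ i, σ (c i) = c' i) (T : Set (Fin (n + 1))) :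
    HomogeneousIdeal.irrelevant (quotGrading (diagonalIdeal c' k T)) ≤
      (HomogeneousIdeal.irrelevant (quotGrading (diagonalIdeal c k T))).map
        (quotGradingMap hc k T) := by
  refine le_trans (α := Ideal _) (irrelevant_le_span_projCoord _) (Ideal.span_le.mpr ?_)
  rintro _ ⟨i, rfl⟩
  have : projCoord (diagonalIdeal c' k T) i =
      quotGradingMap hc k T (projCoord (diagonalIdeal c k T) i) := by
    rw [projCoord, projCoord, quotGradingMap_mk, map_X]
  rw [this]
  exact Ideal.mem_map_of_mem (quotGradingMap hc k T)
    (HomogeneousIdeal.mem_irrelevant_of_mem _ one_pos (projCoord_mem _ i))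

namespace projZeroLocus

/-- The morphism of projective schemes induced by a change of base ring. -/
def baseChange (hc : ∀ i, σ (c i) = c' i) (k : ℕ) (T : Set (Fin (n + 1))) :
    projZeroLocus (diagonalIdeal c' k T) ⟶ projZeroLocus (diagonalIdeal c k T) :=
  Proj.map (quotGradingMap hc k T) (irrelevant_le_map_quotGradingMap hc T)

lemma baseChange_eq (hc : ∀ i, σ (c i) = c' i) (T : Set (Fin (n + 1))) :
    baseChange hc k T =
      Proj.map (quotGradingMap hc k T) (irrelevant_le_map_quotGradingMap hc T) := rfl

lemma isPullback_chartι_baseChange (hc : ∀ i, σ (c i) = c' i) (T : Set (Fin (n + 1)))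
    (j : Fin (n + 1)) :
    IsPullback (chartι (c := c') (k := k) (T := T) (j := j) rfl)
      (Spec.map (CommRingCat.ofHom (DiagonalChart.map σ hc subset_rfl)))
      (baseChange hc k T) (chartι rfl) :=
  isPullback_chartι (c := c) (c' := c') (T := T) (T' := T) (σ := σ) (k := k)
    hc subset_rfl (quotGradingMap hc k T) (quotGradingMap_mk hc T)
    (irrelevant_le_map_quotGradingMap hc T) (baseChange_eq hc T) j

lemma incl_baseChange (hc : ∀ i, σ (c i) = c' i) {T T' : Set (Fin (n + 1))} (h : T ⊆ T') :
    incl (diagonalIdeal_mono c' k h) ≫ baseChange hc k T =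
      baseChange hc k T' ≫ incl (diagonalIdeal_mono c k h) := by
  refine (chartCover c' k T').hom_ext _ _ fun (j : Fin (n + 1)) => ?_
  change chartι (c := c') (k := k) (T := T') (j := j) rfl ≫ incl (diagonalIdeal_mono c' k h) ≫
    baseChange hc k T = chartι rfl ≫ baseChange hc k T' ≫ incl (diagonalIdeal_mono c k h)
  rw [(isPullback_incl h j).w_assoc, (isPullback_chartι_baseChange hc T j).w,
    (isPullback_chartι_baseChange hc T' j).w_assoc, (isPullback_incl h j).w, ← Category.assoc,
    ← Category.assoc, ← Spec.map_comp, ← Spec.map_comp]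
  congr 2
  ext z
  obtain ⟨p, rfl⟩ := DiagonalChart.mk_surjective _ _ _ _ z
  simp [DiagonalChart.factor_mk, DiagonalChart.map_mk]

end projZeroLocus

namespace DiagonalChart

variable {T : Set (Fin (n + 1))} {j : Fin (n + 1)} {B : Type} [CommRing B]

/-- A homomorphism out of a chart after a change of base ring. -/
def baseChangeDesc (hc : ∀ i, σ (c i) = c' i) (f : R' →+* B) (g : DiagonalChart c k T j →+* B)
    (hfg : f.comp σ = g.comp (algebraMap R _)) : DiagonalChart c' k T j →+* B :=
  lift (eval₂Hom f fun l => g (x c k T j l)) <| Ideal.span_le.mpr <| by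
    rintro _ (rfl | rfl | ⟨l, hl, rfl⟩)
    · simp [x_self]
    · have h := congrArg g (sum_eq_zero c k T j)
      have h' (i) : f (c' i) = g (algebraMap R _ (c i)) := by
        rw [← hc]
        exact congr($hfg (c i))
      simpa [h'] using h
    · simp [x_eq_zero c k T j hl]

lemma baseChangeDesc_algebraMap (hc : ∀ i, σ (c i) = c' i) (f : R' →+* B)
    (g : DiagonalChart c k T j →+* B) (hfg : f.comp σ = g.comp (algebraMap R _)) (r : R') :
    baseChangeDesc hc f g hfg (algebraMap R' _ r) = f r :=
  (lift_mk _ _ (C r)).trans (by simp)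

lemma baseChangeDesc_x (hc : ∀ i, σ (c i) = c' i) (f : R' →+* B)
    (g : DiagonalChart c k T j →+* B) (hfg : f.comp σ = g.comp (algebraMap R _)) (l) :
    baseChangeDesc hc f g hfg (x c' k T j l) = g (x c k T j l) :=
  (lift_mk _ _ (X l)).trans (by simp)

lemma map_x (hc : ∀ i, σ (c i) = c' i) {T' : Set (Fin (n + 1))} (hT : T ⊆ T') (l) :
    map (k := k) (j := j) σ hc hT (x c k T j l) = x c' k T' j l :=
  (map_mk hc hT (X l)).trans (by rw [map_X]; rfl)

lemma map_algebraMap (hc : ∀ i, σ (c i) = c' i) {T' : Set (Fin (n + 1))} (hT : T ⊆ T') (r) :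
    map (k := k) (j := j) σ hc hT (algebraMap R (DiagonalChart c k T j) r) =
      algebraMap R' _ (σ r) :=
  (map_mk hc hT (C r)).trans (by rw [map_C]; rfl)

lemma baseChangeDesc_comp_algebraMap (hc : ∀ i, σ (c i) = c' i) (f : R' →+* B)
    (g : DiagonalChart c k T j →+* B) (hfg : f.comp σ = g.comp (algebraMap R _)) :
    (baseChangeDesc hc f g hfg).comp (algebraMap R' (DiagonalChart c' k T j)) = f :=
  RingHom.ext (baseChangeDesc_algebraMap hc f g hfg)

lemma baseChangeDesc_comp_map (hc : ∀ i, σ (c i) = c' i) (f : R' →+* B)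
    (g : DiagonalChart c k T j →+* B) (hfg : f.comp σ = g.comp (algebraMap R _)) :
    (baseChangeDesc hc f g hfg).comp (map σ hc subset_rfl) = g := by
  refine hom_ext (fun r => ?_) fun l => ?_
  · rw [RingHom.comp_apply, map_algebraMap, baseChangeDesc_algebraMap]
    exact congr($hfg r)
  · rw [RingHom.comp_apply, map_x, baseChangeDesc_x]

lemma baseChange_hom_ext (hc : ∀ i, σ (c i) = c' i) {p q : DiagonalChart c' k T j →+* B}
    (h₁ : p.comp (algebraMap R' _) = q.comp (algebraMap R' _))
    (h₂ : p.comp (map (c := c) σ hc subset_rfl) = q.comp (map σ hc subset_rfl)) : p = q := by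
  refine hom_ext (fun r => congr($h₁ r)) fun l => ?_
  rw [← map_x hc (c := c) (c' := c') subset_rfl]
  exact congr($h₂ (x c k T j l))

variable (T j) in
-- A chart is given by generators and relations over `R`, so extending scalars merely replaces the
-- coefficients; the universal property is checked on scalars and coordinates.
lemma isPushout_map (hc : ∀ i, σ (c i) = c' i) :
    IsPushout (CommRingCat.ofHom σ) (CommRingCat.ofHom (algebraMap R (DiagonalChart c k T j)))
      (CommRingCat.ofHom (algebraMap R' (DiagonalChart c' k T j)))
      (CommRingCat.ofHom (map σ hc subset_rfl)) := by
  have hs (s : Limits.PushoutCocone (CommRingCat.ofHom σ)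
      (CommRingCat.ofHom (algebraMap R (DiagonalChart c k T j)))) :
      s.inl.hom.comp σ = s.inr.hom.comp (algebraMap R _) :=
    congrArg CommRingCat.Hom.hom s.condition
  refine .of_isColimit' ⟨?_⟩ (Limits.PushoutCocone.IsColimit.mk _
    (fun s => CommRingCat.ofHom (baseChangeDesc hc s.inl.hom s.inr.hom (hs s)))
    (fun s => ?_) (fun s => ?_) (fun s m hm₁ hm₂ => ?_))
  · ext r
    exact (map_algebraMap hc subset_rfl r).symm
  · exact CommRingCat.hom_ext (baseChangeDesc_comp_algebraMap hc _ _ (hs s))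
  · exact CommRingCat.hom_ext (baseChangeDesc_comp_map hc _ _ (hs s))
  · refine CommRingCat.hom_ext (baseChange_hom_ext hc ?_ ?_)
    · exact (congrArg CommRingCat.Hom.hom hm₁).trans
        (baseChangeDesc_comp_algebraMap hc _ _ (hs s)).symm
    · exact (congrArg CommRingCat.Hom.hom hm₂).trans (baseChangeDesc_comp_map hc _ _ (hs s)).symm

end DiagonalChart

namespace projZeroLocus

/-- Being Cartesian may be tested over the charts of the target, where it is the pushout square of
coordinate rings. -/
lemma isPullback_baseChange (hc : ∀ i, σ (c i) = c' i) (T : Set (Fin (n + 1))) :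
    IsPullback (baseChange hc k T) (toSpec (diagonalIdeal c' k T))
      (toSpec (diagonalIdeal c k T)) (Spec.map (CommRingCat.ofHom σ)) := by
  refine Scheme.isPullback_of_openCover _ _ _ _ (chartCover c k T) fun (j : Fin (n + 1)) => ?_
  have h1 := isPullback_SpecMap_of_isPushout _ _ _ _ (DiagonalChart.isPushout_map (k := k) T j hc)
  have hp := isPullback_chartι_baseChange (k := k) hc T j
  refine h1.flip.of_iso hp.isoPullback (Iso.refl _) (Iso.refl _) (Iso.refl _) ?_ ?_ ?_ ?_
  · exact (hp.isoPullback_hom_snd.trans (Category.comp_id _).symm).symm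
  · rw [Iso.refl_hom, Category.comp_id]
    change _ = hp.isoPullback.hom ≫ Limits.pullback.fst _ _ ≫ _
    rw [hp.isoPullback_hom_fst_assoc, chartι_toSpec]
  · exact (Category.comp_id _).trans
      ((chartι_toSpec (c := c) (k := k) (T := T) (j := j) rfl).symm.trans (Category.id_comp _).symm)
  · simp

end projZeroLocus

end

/-! ### Properness, regularity and closures of the generic divisors -/

noncomputable section

open MvPolynomial

attribute [local instance] MvPolynomial.gradedAlgebra

namespace AlgebraicGeometry

lemma isRegularLocalRing_stalk_spec (A : Type) [CommRing A] [IsRegularRing A] (x : PrimeSpectrum A) :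
    IsRegularLocalRing ((Spec (.of A)).presheaf.stalk x) :=
  .of_ringEquiv (R := Localization.AtPrime x.asIdeal)
    (Spec.stalkIso (.of A) x).commRingCatIsoToRingEquiv.symm

lemma isSchemeTheoreticallyDominant_SpecMap {A B : Type} [CommRing A] [CommRing B] [_root_.IsReduced A]
    {φ : A →+* B} (hφ : Function.Injective φ) :
    IsSchemeTheoreticallyDominant (Spec.map (CommRingCat.ofHom φ)) := by
  have : IsDominant (Spec.map (CommRingCat.ofHom φ)) := by
    rw [isDominant_iff]
    exact PrimeSpectrum.denseRange_comap_iff_ker_le_nilRadical φ |>.mpr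
      ((RingHom.injective_iff_ker_eq_bot φ).mp hφ ▸ bot_le)
  have : IsReduced (Spec (.of A)) := inferInstance
  exact .of_isDominant _

lemma isRegularLocalRing_stalk_of_isOpenImmersion {X Y : Scheme.{0}} (f : X ⟶ Y)
    [IsOpenImmersion f] (x : X) [IsRegularLocalRing (X.presheaf.stalk x)] :
    IsRegularLocalRing (Y.presheaf.stalk (f x)) :=
  .of_ringEquiv (asIso (f.stalkMap x)).commRingCatIsoToRingEquiv.symm

end AlgebraicGeometry

variable {R : Type} [CommRing R] {n : ℕ} {c : Fin (n + 1) → R} {k : ℕ}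

instance algebra_finiteType_quotGrading_zero
    (I : HomogeneousIdeal (homogeneousSubmodule (Fin (n + 1)) R)) :
    Algebra.FiniteType (quotGrading I 0) (MvPolynomial (Fin (n + 1)) R ⧸ I.toIdeal) :=
  have : Algebra.FiniteType R (MvPolynomial (Fin (n + 1)) R ⧸ I.toIdeal) := inferInstance
  have : IsScalarTower R (quotGrading I 0) (MvPolynomial (Fin (n + 1)) R ⧸ I.toIdeal) :=
    IsScalarTower.of_algebraMap_eq (R := R) (S := quotGrading I 0)
      (A := MvPolynomial (Fin (n + 1)) R ⧸ I.toIdeal) fun _ => rfl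
  .of_restrictScalars_finiteType R _ _

/-- A form of degree zero is a constant. Thus the spectrum of the degree-zero part is closed in
`Spec R`, and properness over it gives properness over `R`. -/
lemma algebraMap_quotGrading_zero_surjective
    (I : HomogeneousIdeal (homogeneousSubmodule (Fin (n + 1)) R)) :
    Function.Surjective (algebraMap R (quotGrading I 0)) := by
  rintro ⟨_, p, hp, rfl⟩
  refine ⟨coeff 0 p, Subtype.ext ?_⟩
  have : p = C (coeff 0 p) := by
    rw [← totalDegree_eq_zero_iff_eq_C]
    exact Nat.le_zero.mp ((mem_homogeneousSubmodule _ _).mp hp).totalDegree_le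
  exact congrArg (Ideal.Quotient.mk I.toIdeal) this.symm

namespace projZeroLocus

instance isProper_toSpec (I : HomogeneousIdeal (homogeneousSubmodule (Fin (n + 1)) R)) :
    IsProper (toSpec I) := by
  have := IsClosedImmersion.spec_of_surjective
    (CommRingCat.ofHom (algebraMap R (quotGrading I 0))) (algebraMap_quotGrading_zero_surjective I)
  have h₁ : IsProper (Proj.toSpecZero (quotGrading I)) := inferInstance
  have h₂ : IsProper (Spec.map (CommRingCat.ofHom (algebraMap R (quotGrading I 0)))) :=
    inferInstance
  exact MorphismProperty.comp_mem @IsProper _ _ h₁ h₂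

lemma isRegularScheme [IsRegularRing R] (hc : ∀ i, IsUnit (c i)) (hk : k ≠ 0)
    (hu : IsUnit (k : R)) (T : Set (Fin (n + 1))) :
    IsRegularScheme (projZeroLocus (diagonalIdeal c k T)) where
  isLocallyNoetherian := by
    have := isProper_toSpec (diagonalIdeal c k T)
    have : IsLocallyNoetherian (Spec (.of R)) := inferInstance
    exact LocallyOfFiniteType.isLocallyNoetherian (toSpec (diagonalIdeal c k T))
  isRegularLocalRing_stalk x := by
    obtain ⟨j, y, rfl⟩ : ∃ j : Fin (n + 1), ∃ y : PrimeSpectrum (DiagonalChart c k T j),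
      chartι rfl y = x := (chartCover c k T).exists_eq x
    have h := smooth_toSpec hc hk hu T
    have h₁ : Smooth (chartι (c := c) (k := k) (T := T) (j := j) rfl ≫
      toSpec (diagonalIdeal c k T)) := smooth_comp _ _
    rw [chartι_toSpec, HasRingHomProperty.Spec_iff (P := @Smooth)] at h₁
    have : Algebra.Smooth R (DiagonalChart c k T j) :=
      RingHom.smooth_algebraMap.mp h₁
    have : IsRegularRing (DiagonalChart c k T j) := .of_smooth R _
    have := isRegularLocalRing_stalk_spec (DiagonalChart c k T j) y
    exact isRegularLocalRing_stalk_of_isOpenImmersion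
      (chartι (c := c) (k := k) (T := T) (j := j) rfl) y

variable {R' : Type} [CommRing R'] {σ : R →+* R'} {c' : Fin (n + 1) → R'}

/-- The subscheme for `T'` is flat over `R`, so the dominance of `Spec R' ⟶ Spec R` survives base
change to it: no nonzero ideal sheaf on it dies on the `R'`-fibre. The pushed-forward ideal is the
kernel of the composite through this subscheme, which is therefore the kernel of its inclusion. -/
lemma ker_incl_map_baseChange [IsReduced R] (hc : ∀ i, IsUnit (c i)) (hk : k ≠ 0)
    (hu : IsUnit (k : R)) (hσ : Function.Injective σ) (hc' : ∀ i, σ (c i) = c' i)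
    {T T' : Set (Fin (n + 1))} (h : T ⊆ T') :
    (incl (diagonalIdeal_mono c' k h)).ker.map (baseChange hc' k T) =
      (incl (diagonalIdeal_mono c k h)).ker := by
  have := isSchemeTheoreticallyDominant_SpecMap hσ
  have := smooth_toSpec hc hk hu T'
  have : Flat (toSpec (diagonalIdeal c k T')) := inferInstance
  have hd : IsSchemeTheoreticallyDominant (baseChange hc' k T') :=
    .of_isPullback (isPullback_baseChange hc' T').flip
  rw [Scheme.IdealSheafData.map_ker, incl_baseChange hc' h, Scheme.Hom.ker_comp, hd.ker_eq_bot,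
    Scheme.IdealSheafData.map_bot]

end projZeroLocus

lemma diagonalPair_isGoodIntegralModel {F : Type} [Field F] [Algebra R F] [IsReduced R]
    [IsRegularRing R] (hF : Function.Injective (algebraMap R F)) (hc : ∀ i, IsUnit (c i))
    (hk : k ≠ 0) (hu : IsUnit (k : R)) {c' : Fin (n + 1) → F}
    (hc' : ∀ i, algebraMap R F (c i) = c' i) (m : Fin (n + 1) → ℕ) :
    IsGoodIntegralModel (diagonalPair F c' k m) (diagonalPair R c k m) where
  flat := by
    have := projZeroLocus.smooth_toSpec hc hk hu ∅
    have : Flat (projZeroLocus.toSpec (diagonalIdeal c k ∅)) := inferInstance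
    exact this
  proper := projZeroLocus.isProper_toSpec (diagonalIdeal c k ∅)
  weights := rfl
  exists_genericFibre := ⟨projZeroLocus.baseChange hc' k ∅,
    projZeroLocus.isPullback_baseChange hc' ∅, fun _ =>
      (projZeroLocus.ker_incl_map_baseChange hc hk hu hF hc' (Set.empty_subset _)).symm⟩
  regular := projZeroLocus.isRegularScheme hc hk hu ∅

end

/-! ### Rings of `S`-integers and the conclusion -/

/-- Divide a Bézout relation `u * num + v * den = 1` by the denominator: `1 / den = u * q + v`. -/
lemma Subalgebra.inv_den_mem (A : Subalgebra ℤ ℚ) {q : ℚ} (hq : q ∈ A) : (q.den : ℚ)⁻¹ ∈ A := by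
  have h : IsCoprime q.num (q.den : ℤ) :=
    Int.isCoprime_iff_gcd_eq_one.mpr q.reduced
  obtain ⟨u, v, huv⟩ := h
  have hd : (q.den : ℚ) ≠ 0 := by exact_mod_cast q.den_nz
  have : (q.den : ℚ)⁻¹ = algebraMap ℤ ℚ u * q + algebraMap ℤ ℚ v := by
    have h1 : (u : ℚ) * q.num + v * q.den = 1 := by exact_mod_cast huv
    have h2 : q * q.den = q.num := Rat.mul_den_eq_num q
    rw [eq_intCast, eq_intCast, inv_eq_iff_eq_inv, eq_comm, inv_eq_of_mul_eq_one_left]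
    rw [← h1, ← h2]
    ring
  rw [this]
  exact add_mem (mul_mem (A.algebraMap_mem _) hq) (A.algebraMap_mem _)

/-- A ring between `ℤ` and `ℚ` is a localization of `ℤ`. -/
instance Subalgebra.isLocalization_int (A : Subalgebra ℤ ℚ) :
    IsLocalization ((IsUnit.submonoid A).comap (algebraMap ℤ A)) A where
  map_units m := m.2
  surj x := by
    have hd : (x.1.den : ℚ) ≠ 0 := by exact_mod_cast x.1.den_nz
    refine ⟨⟨x.1.num, ⟨x.1.den, ?_⟩⟩, ?_⟩
    · refine IsUnit.of_mul_eq_one ⟨_, A.inv_den_mem x.2⟩ (Subtype.ext ?_)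
      change ((x.1.den : ℤ) : ℚ) * _ = 1
      rw [Int.cast_natCast, mul_inv_cancel₀ hd]
    · refine Subtype.ext ?_
      change x.1 * ((x.1.den : ℤ) : ℚ) = (x.1.num : ℚ)
      rw [Int.cast_natCast, Rat.mul_den_eq_num]
  exists_of_eq {x y} h := by
    refine ⟨1, ?_⟩
    have : (x : ℚ) = (y : ℚ) := congrArg Subtype.val h
    rw [Int.cast_inj.mp this]

instance Subalgebra.isDedekindDomain_of_int (A : Subalgebra ℤ ℚ) : IsDedekindDomain A := by
  refine IsLocalization.isDedekindDomain ℤ (M := (IsUnit.submonoid A).comap (algebraMap ℤ A)) ?_ A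
  intro m hm
  refine mem_nonZeroDivisors_of_ne_zero ?_
  rintro rfl
  exact not_isUnit_zero (map_zero (algebraMap ℤ A) ▸ hm : IsUnit (0 : A))

/-- A prime at which `a` has valuation below `1` contains `a`, hence its multiple `b`, and so
belongs to `S`. Outside `S` the inverse of `a` is therefore integral. -/
lemma Set.isUnit_integer_of_dvd (S : Set (HeightOneSpectrum ℤ)) {a b : ℤ} (hb : b ≠ 0)
    (hS : ∀ p : HeightOneSpectrum ℤ, b ∈ p.asIdeal → p ∈ S) (hab : a ∣ b) :
    IsUnit (algebraMap ℤ (S.integer ℚ) a) := by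
  have ha : (a : ℚ) ≠ 0 := by exact_mod_cast fun h : a = 0 => hb (zero_dvd_iff.mp (h ▸ hab))
  refine IsUnit.of_mul_eq_one ⟨(a : ℚ)⁻¹, fun v hv => ?_⟩ (Subtype.ext ?_)
  · have h1 : v.valuation ℚ (a : ℚ) = 1 := by
      refine le_antisymm (v.valuation_le_one a) (not_lt.mp fun h => hv (hS v ?_))
      exact Ideal.mem_of_dvd _ hab ((v.valuation_lt_one_iff_mem a).mp h)
    rw [map_inv₀, h1, inv_one]
  · exact mul_inv_cancel₀ ha

theorem lemma4p3 (n k : ℕ) (hn : 1 ≤ n) (hk : 1 ≤ k)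
    (c : Fin (n + 1) → ℤ) (hc : ∀ i, c i ≠ 0) (hgcd : Finset.univ.gcd c = 1)
    (m : Fin (n + 1) → ℕ) (hm : ∀ i, 2 ≤ m i)
    (S : Set (HeightOneSpectrum ℤ)) (hfin : S.Finite)
    (hS : ∀ p : HeightOneSpectrum ℤ, (k : ℤ) * ∏ i, c i ∈ p.asIdeal → p ∈ S) :
    Smooth (diagonalPair (S.integer ℚ) (fun i => algebraMap ℤ (S.integer ℚ) (c i)) k m).str ∧
    (diagonalPair (S.integer ℚ)
      (fun i => algebraMap ℤ (S.integer ℚ) (c i)) k m).IsSmoothPair (n - 1) ∧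
    IsGoodIntegralModel
      (diagonalPair ℚ (fun i => (c i : ℚ)) k m)
      (diagonalPair (S.integer ℚ) (fun i => algebraMap ℤ (S.integer ℚ) (c i)) k m) := by
  have hk₀ : k ≠ 0 := Nat.one_le_iff_ne_zero.mp hk
  have h₀ : (k : ℤ) * ∏ i, c i ≠ 0 :=
    mul_ne_zero (by exact_mod_cast hk₀) (Finset.prod_ne_zero_iff.mpr fun i _ => hc i)
  -- Each `cᵢ`, and likewise `k`, divides `k * ∏ cᵢ`, whose prime divisors all lie in `S`.
  have hcu (i) : IsUnit (algebraMap ℤ (S.integer ℚ) (c i)) :=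
    S.isUnit_integer_of_dvd h₀ hS
      ((Finset.dvd_prod_of_mem c (Finset.mem_univ i)).trans (dvd_mul_left _ _))
  have hku : IsUnit (k : S.integer ℚ) := by
    have := S.isUnit_integer_of_dvd h₀ hS (dvd_mul_right (k : ℤ) _)
    rwa [map_natCast] at this
  exact ⟨diagonalPair_smooth hcu hk₀ hku m, diagonalPair_isSmoothPair hcu hk₀ hku hn m,
    diagonalPair_isGoodIntegralModel Subtype.val_injective hcu hk₀ hku (fun _ => rfl) m⟩
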